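/- Let $f(x)=\sum_{j} a_j e^{\mathrm i jx}$ (a finite sum) be a real-valued trigonometric polynomial with $f(x)>0$ for $x\in(0,2\pi)$ and a zero of exact order $m\ge 1$ at $0$, i.e. $D^\mu f(0)=0$ for $\mu=0,\dots,m-1$ and $D^m f(0)\neq 0$. Let $g\ge 2$ be an integer and let $\mathbf p=(\mathrm p_\alpha)_{\alpha\in\mathbb Z}$ be a finitely supported real mask with $\mathrm p_{-\alpha}=\mathrm p_\alpha$. The subdivision operator is $(S_{\mathbf p}\mathbf c)_\alpha=\sum_{\beta}\mathrm p_{\alpha-g\beta}\mathrm c_\beta$. Assume that $S_{\mathbf p}$ is convergent: for every bounded real sequence $\mathbf c$ there is a uniformly continuous $F_{\mathbf c}:\mathbb R\to\mathbb R$ with $\lim_{k\to\infty}\sup_{\alpha}|F_{\mathbf c}(\alpha/g^k)-(S_{\mathbf p}^k\mathbf c)_\alpha|=0$, and $F_{\mathbf c}\not\equiv 0$ for some $\mathbf c$. Let $\phi=F_{\boldsymbol\delta}$ be the basic limit function, where $\boldsymbol\delta=(\delta_{\alpha,0})_{\alpha\in\mathbb Z}$. Assume that $S_{\mathbf p}$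 generates polynomials up to degree $d=\lceil m/2\rceil-1$: for every real polynomial $\pi$ of degree at most $d$, the function $\sum_{\alpha}\pi(\alpha)\,\phi(\cdot-\alpha)$ is a polynomial of degree at most $d$. For $n=g^{k}$, $k\ge 1$, and $N=n/g$, let $A_n=C_n(f)\in\mathbb C^{n\times n}$ be the circulant matrix with entries $(A_n)_{r,s}=\sum_{j\equiv r-s \ (\mathrm{mod}\ n)}a_j$, $0\le r,s\le n-1$, let $C_n(p)$ be the circulant matrix formed in the same way from the coefficients $\mathrm p_\alpha$, let $K_{n,g}\in\mathbb C^{N\times n}$ be the downsampling matrix with $(K_{n,g})_{i,j}=1$ if $j=gi$ and $0$ otherwise, and let $P_n=C_n(p)K_{n,g}^T\in\mathbb C^{n\times N}$. Assume that each $P_n$ is an admissible grid transfer operator, i.e. $\operatorname{rank}P_n=N$. Then the two-grid approximation property holds: with $D_n$ the diagonal part of $A_n$ and $\|\mathbf x\|_B^2=\mathbf x^HB\mathbf x$, there exists $\gamma>0$ independent of $n$ such that for all $n=g^k$, $k\ge1$, $$\min_{\mathbf y\in\mathbb C^N}\|\mathbf x-P_n\mathbf y\|_{D_n}^2\le\gamma\,\|\mathbf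 x\|_{A_n}^2\qquad\text{for all }\mathbf x\in\mathbb C^n .$$ -/

import Mathlib

open scoped Matrix

noncomputable section

namespace SubdivisionTGM

/-! ### Univariate subdivision schemes of arity `g` -/

/-- The subdivision operator `(S_p c)_α = ∑_β p_{α - g β} c_β` with finitely supported real mask `p`
(a finite sum for every `α`, since `g ≠ 0` in all uses). -/
def subdivisionOp (g : ℕ) (p : ℤ →₀ ℝ) (c : ℤ → ℝ) : ℤ → ℝ :=
  fun α => ∑ᶠ β : ℤ, p (α - (g : ℤ) * β) * c β

/-- `c ∈ ℓ^∞(ℤ)`. -/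
def IsBoundedSeq (c : ℤ → ℝ) : Prop := ∃ M : ℝ, ∀ α, |c α| ≤ M

/-- `F` is the limit of the scheme for the initial data `c`: it is uniformly continuous and
`sup_α |F(α / g^k) - (S_p^k c)_α| → 0` as `k → ∞`. -/
def IsLimitFunction (g : ℕ) (p : ℤ →₀ ℝ) (c : ℤ → ℝ) (F : ℝ → ℝ) : Prop :=
  UniformContinuous F ∧
    ∀ ε : ℝ, 0 < ε → ∃ K : ℕ, ∀ k : ℕ, K ≤ k → ∀ α : ℤ,
      |F ((α : ℝ) / (g : ℝ) ^ k) - ((subdivisionOp g p)^[k] c) α| ≤ ε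

/-- Convergence of the scheme: every bounded initial sequence has a limit function, and (as always
in the notion of convergence) the scheme is not degenerate: not all limit functions vanish
identically. -/
def IsConvergent (g : ℕ) (p : ℤ →₀ ℝ) : Prop :=
  (∀ c : ℤ → ℝ, IsBoundedSeq c → ∃ F : ℝ → ℝ, IsLimitFunction g p c F) ∧
    ∃ (c : ℤ → ℝ) (F : ℝ → ℝ), IsBoundedSeq c ∧ IsLimitFunction g p c F ∧ ∃ t, F t ≠ 0

/-- The sequence `δ`. -/
def delta : ℤ → ℝ := Pi.single 0 1

/-- The scheme generates polynomials up to degree `d`: with the basic limit function `φ = F_δ`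
(unique, and compactly supported, so that the sums below are finite), for every polynomial `π` of
degree at most `d` the function `∑_α π(α) φ(· - α)` is a polynomial of degree at most `d`. -/
def GeneratesPolynomials (g : ℕ) (p : ℤ →₀ ℝ) (d : ℕ) : Prop :=
  ∃ φ : ℝ → ℝ, IsLimitFunction g p delta φ ∧
    ∀ q : Polynomial ℝ, q.natDegree ≤ d →
      ∃ r : Polynomial ℝ, r.natDegree ≤ d ∧
        ∀ t : ℝ, HasSum (fun α : ℤ => q.eval (α : ℝ) * φ (t - α)) (r.eval t)

/-! ### Circulant matrices and the grid transfer operator -/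

/-- The trigonometric polynomial `x ↦ ∑_j a_j e^{i j x}`. -/
def trigPoly (a : ℤ →₀ ℂ) (x : ℝ) : ℂ :=
  a.sum fun j c => c * Complex.exp (Complex.I * (j : ℂ) * (x : ℂ))

/-- The circulant matrix `C_n` of the trigonometric polynomial with coefficients `a`: its entry
`(r, s)` is the sum of all `a_j` with `j ≡ r - s` modulo `n`. -/
def circ (n : ℕ) (a : ℤ →₀ ℂ) : Matrix (Fin n) (Fin n) ℂ :=
  Matrix.of fun r s =>
    a.sum fun j c => if (n : ℤ) ∣ j - (((r : ℕ) : ℤ) - ((s : ℕ) : ℤ)) then c else 0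

/-- If the degree of the trigonometric polynomial is less than `n`, the entries of `C_n` are
`a_{(r-s) mod n} + a_{(r-s) mod n - n}`. -/
theorem circ_apply_of_degree_lt (n : ℕ) (a : ℤ →₀ ℂ) (ha : ∀ j ∈ a.support, |j| < (n : ℤ))
    (r s : Fin n) :
    circ n a r s =
      a ((((r : ℕ) : ℤ) - ((s : ℕ) : ℤ)) % n) + a ((((r : ℕ) : ℤ) - ((s : ℕ) : ℤ)) % n - n) := by
  have hn : (0 : ℤ) < n := by
    have := r.pos
    omega
  set l : ℤ := ((r : ℕ) : ℤ) - ((s : ℕ) : ℤ) with hl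
  have h0 : 0 ≤ l % n := Int.emod_nonneg _ hn.ne'
  have h1 : l % n < n := Int.emod_lt_of_pos _ hn
  have key : ∀ j ∈ a.support, (if (n : ℤ) ∣ j - l then a j else 0) =
      (if j = l % n then a j else 0) + (if j = l % n - n then a j else 0) := by
    intro j hj
    have hjn := abs_lt.mp (ha j hj)
    have hiff : (n : ℤ) ∣ j - l ↔ (j = l % n ∨ j = l % n - n) := by
      have hd : (n : ℤ) ∣ j - l ↔ (n : ℤ) ∣ j - l % n := by
        have : j - l = (j - l % n) - n * (l / n) := by
          have := Int.emod_add_mul_ediv l n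
          linarith
        rw [this]
        exact dvd_sub_left (Dvd.intro _ rfl)
      rw [hd]
      constructor
      · rintro ⟨t, ht⟩
        have ht1 : t < 1 := by nlinarith
        have ht2 : -2 < t := by nlinarith
        have : t = 0 ∨ t = -1 := by omega
        rcases this with rfl | rfl
        · left; linarith
        · right; linarith
      · rintro (h | h)
        · simp [h]
        · rw [h]; exact ⟨-1, by ring⟩
    by_cases hA : j = l % n
    · have hB : ¬ (j = l % n - n) := by omega
      rw [if_pos (hiff.2 (Or.inl hA)), if_pos hA, if_neg hB, add_zero]
    · by_cases hB : j = l % n - n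
      · rw [if_pos (hiff.2 (Or.inr hB)), if_neg hA, if_pos hB, zero_add]
      · rw [if_neg (fun h => (hiff.1 h).elim hA hB), if_neg hA, if_neg hB, add_zero]
  have hsum : circ n a r s = ∑ j ∈ a.support, if (n : ℤ) ∣ j - l then a j else 0 := rfl
  rw [hsum, Finset.sum_congr rfl key, Finset.sum_add_distrib, Finset.sum_ite_eq',
    Finset.sum_ite_eq']
  congr 1 <;> · split_ifs with h
                · rfl
                · exact (Finsupp.notMem_support_iff.mp h).symm

/-- The downsampling matrix of factor `g`: row `i` has its only nonzero entry, a `1`, in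
column `g i`. -/
def downsampling (g N n : ℕ) : Matrix (Fin N) (Fin n) ℂ :=
  Matrix.of fun i j => if (j : ℕ) = g * (i : ℕ) then 1 else 0

/-- The coefficients `p_α` of the symbol on the unit circle, as complex numbers. -/
def maskCoeff (p : ℤ →₀ ℝ) : ℤ →₀ ℂ := p.mapRange (fun t : ℝ => (t : ℂ)) Complex.ofReal_zero

/-- The grid transfer operator `P_n = C_n(p) K_{n,g}^T` for `n = g^(k+1)`, `N = n / g = g^k`. -/
def gridTransfer (g : ℕ) (p : ℤ →₀ ℝ) (k : ℕ) : Matrix (Fin (g ^ (k + 1))) (Fin (g ^ k)) ℂ :=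
  circ (g ^ (k + 1)) (maskCoeff p) * (downsampling g (g ^ k) (g ^ (k + 1)))ᵀ

/-! ### The two-grid approximation property -/

/-- `‖x‖_A^2 = x^H A x`, for a hermitian positive semidefinite matrix `A`. -/
def energySq {n : ℕ} (A : Matrix (Fin n) (Fin n) ℂ) (x : Fin n → ℂ) : ℝ :=
  (star x ⬝ᵥ (A *ᵥ x)).re

/-- The approximation property of the family of matrices `A k` of size `n k` with grid transfer
operators `P k`: there is `γ > 0`, independent of `k`, with
`min_y ‖x - P y‖_D^2 ≤ γ ‖x‖_A^2` for all `x`, where `D` is the diagonal part of `A`. -/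
def ApproximationProperty (n N : ℕ → ℕ) (A : ∀ k, Matrix (Fin (n k)) (Fin (n k)) ℂ)
    (P : ∀ k, Matrix (Fin (n k)) (Fin (N k)) ℂ) : Prop :=
  ∃ γ : ℝ, 0 < γ ∧ ∀ (k : ℕ) (x : Fin (n k) → ℂ), ∃ y : Fin (N k) → ℂ,
    energySq (Matrix.diagonal (A k).diag) (x - P k *ᵥ y) ≤ γ * energySq (A k) x

end SubdivisionTGM

end

/-!
The energy of a circulant matrix is diagonal in the discrete Fourier basis, with weights `f`, and
the grid transfer operator couples only the `g` frequencies `w` with a common value of `w ^ g`,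
through the values of the symbol `P(z) = ∑ p_α z^α` (`mul_energySq_circ`,
`fourierSum_gridTransfer_mulVec`). Hence the approximation property reduces to an estimate for `g`
frequencies at a time: the coarse vector reproduces the Fourier coefficient at the frequency `z`
closest to `1`, which is possible with a bounded factor if `P(1) ≠ 0`, and the error made at the
other frequencies `w = ω z`, `ω ^ g = 1`, is at most a multiple of `|P(ω z)|² |x̂(z)|²`. If `P` has
zeros of order `d + 1 = ⌈m / 2⌉` at all `ω ≠ 1`, this is `O(|z - 1|^m |x̂(z)|²)`, which the energy
bounds because `f` vanishes at `1` to order exactly `m` and nowhere else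
(`approximationProperty_of_dvd`).

It remains to see that polynomial generation forces these zeros (`pow_dvd_maskPoly`). In general it
does not: the integer translates of the basic limit function `φ` may be linearly dependent. A zero
of too low an order at `ω` would produce the dependence `∑_α ω^α φ(· - α) = 0`. By the refinement
equation such a dependence for `z ^ g` is inherited by `z` whenever `P(z) ≠ 0`, and full rank of
the grid transfer operators provides such a root `z` at every level
(`exists_maskSymbol_ne_zero`). This yields dependences for infinitely many `z`, although, `φ` being
nonzero with compact support, they are zeros of a nonzero Laurent polynomial
(`translateComb_zpow_ne_zero`). Applied on the coarsest grid, full rank also gives `P(1) ≠ 0`.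

Sequences are treated as a module over `ℂ[X]`, with `X` acting as the translation `shiftEnd`, and the
symbol is multiplied by a power of `X` to become the polynomial `maskPoly`.
-/

noncomputable section

namespace SubdivisionTGM

open Polynomial Filter Topology

/-! ### The subdivision operator and its limit functions -/

/-- Upsampling by the factor `g`: the entries of `c` are placed at the multiples of `g`, and the
remaining entries are `0`. -/
def upsample {R : Type*} [Zero R] (g : ℕ) (c : ℤ → R) : ℤ → R :=
  fun α => if (g : ℤ) ∣ α then c (α / g) else 0

theorem upsample_mul {R : Type*} [Zero R] {g : ℕ} (hg : g ≠ 0) (c : ℤ → R) (β : ℤ) :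
    upsample g c (g * β) = c β := by
  have : (g : ℤ) ≠ 0 := by exact_mod_cast hg
  simp only [upsample, dvd_mul_right, if_true, Int.mul_ediv_cancel_left _ this]

theorem subdivisionOp_eq_sum {g : ℕ} (hg : g ≠ 0) (p : ℤ →₀ ℝ) (c : ℤ → ℝ) (α : ℤ) :
    subdivisionOp g p c α = ∑ γ ∈ p.support, p γ * upsample g c (α - γ) := by
  have hg' : (g : ℤ) ≠ 0 := by exact_mod_cast hg
  have hinj : Function.Injective fun β : ℤ => α - (g : ℤ) * β := by
    intro β β' h
    exact mul_left_cancel₀ hg' (sub_right_injective h)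
  have hsub : (Function.support fun γ => p γ * upsample g c (α - γ)) ⊆ ↑p.support := by
    intro γ hγ
    simp only [Function.mem_support, ne_eq, mul_eq_zero, not_or] at hγ
    simpa using hγ.1
  rw [← finsum_eq_sum_of_support_subset _ hsub]
  have h1 : subdivisionOp g p c α = ∑ᶠ β : ℤ, p (α - (g : ℤ) * β) *
      upsample g c (α - (α - (g : ℤ) * β)) := by
    refine finsum_congr fun β => ?_
    rw [sub_sub_cancel, upsample_mul hg]
  rw [h1, ← finsum_mem_range (f := fun γ => p γ * upsample g c (α - γ)) hinj,
    ← finsum_mem_univ (fun γ => p γ * upsample g c (α - γ))]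
  refine finsum_mem_inter_support_eq _ _ _ ?_
  ext γ
  simp only [Set.mem_inter_iff, Set.mem_range, Function.mem_support, Set.mem_univ, true_and,
    and_iff_right_iff_imp]
  intro h
  by_contra h'
  apply h
  have : ¬ (g : ℤ) ∣ α - γ := by
    rintro ⟨β, hβ⟩
    exact h' ⟨β, by rw [← hβ]; ring⟩
  simp [upsample, this]

/-- The subdivision operator as a linear endomorphism of the space of real sequences. -/
def subdivisionLin (g : ℕ) (p : ℤ →₀ ℝ) : Module.End ℝ (ℤ → ℝ) where
  toFun c := fun α => ∑ γ ∈ p.support, p γ * upsample g c (α - γ)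
  map_add' c c' := by
    ext α
    rw [Pi.add_apply, ← Finset.sum_add_distrib]
    refine Finset.sum_congr rfl fun γ _ => ?_
    unfold upsample
    split_ifs <;> simp [mul_add]
  map_smul' t c := by
    ext α
    simp only [RingHom.id_apply, Pi.smul_apply, smul_eq_mul, Finset.mul_sum]
    refine Finset.sum_congr rfl fun γ _ => ?_
    unfold upsample
    split_ifs <;> simp [mul_left_comm]

theorem subdivisionLin_apply (g : ℕ) (p : ℤ →₀ ℝ) (c : ℤ → ℝ) (α : ℤ) :
    subdivisionLin g p c α = ∑ γ ∈ p.support, p γ * upsample g c (α - γ) := rfl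

theorem subdivisionOp_iterate {g : ℕ} (hg : g ≠ 0) (p : ℤ →₀ ℝ) (k : ℕ) (c : ℤ → ℝ) :
    (subdivisionOp g p)^[k] c = (subdivisionLin g p ^ k) c := by
  have : subdivisionOp g p = subdivisionLin g p := by
    ext c α
    rw [subdivisionOp_eq_sum hg, subdivisionLin_apply]
  rw [this, Module.End.pow_apply]

theorem upsample_shift {R : Type*} [Zero R] {g : ℕ} (hg : g ≠ 0) (c : ℤ → R) (a α : ℤ) :
    upsample g (fun β => c (β - a)) α = upsample g c (α - g * a) := by
  have hg' : (g : ℤ) ≠ 0 := by exact_mod_cast hg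
  unfold upsample
  have h : (g : ℤ) ∣ α - g * a ↔ (g : ℤ) ∣ α := dvd_sub_left (Dvd.intro _ rfl)
  simp only [h]
  split_ifs with h1
  · congr 1
    obtain ⟨b, rfl⟩ := h1
    rw [← mul_sub, Int.mul_ediv_cancel_left _ hg', Int.mul_ediv_cancel_left _ hg']
  · rfl

theorem subdivisionLin_pow_shift {g : ℕ} (hg : g ≠ 0) (p : ℤ →₀ ℝ) (k : ℕ) (c : ℤ → ℝ)
    (a α : ℤ) :
    (subdivisionLin g p ^ k) (fun β => c (β - a)) α =
      (subdivisionLin g p ^ k) c (α - (g : ℤ) ^ k * a) := by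
  induction k generalizing α with
  | zero => simp
  | succ k ih =>
    rw [pow_succ', Module.End.mul_apply, Module.End.mul_apply, subdivisionLin_apply,
      subdivisionLin_apply]
    refine Finset.sum_congr rfl fun γ _ => ?_
    have : (subdivisionLin g p ^ k) (fun β => c (β - a)) =
        fun β => (subdivisionLin g p ^ k) c (β - (g : ℤ) ^ k * a) := funext fun β => ih β
    rw [this, upsample_shift hg]
    congr 2
    ring

/-- The subdivision operator is local: `(S^k c)_α` only depends on the entries `c_β` for which
`β` is within distance `L` of `α / g^k`, where `[-L, L]` contains the support of the mask. -/
theorem subdivisionLin_pow_eq_zero {g : ℕ} (hg : 2 ≤ g) {p : ℤ →₀ ℝ} {L : ℕ}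
    (hL : ∀ γ ∈ p.support, |γ| ≤ (L : ℤ)) (k : ℕ) (c : ℤ → ℝ) (α : ℤ)
    (hc : ∀ β : ℤ, |(g : ℤ) ^ k * β - α| ≤ L * ((g : ℤ) ^ k - 1) → c β = 0) :
    (subdivisionLin g p ^ k) c α = 0 := by
  have hg' : (2 : ℤ) ≤ g := by exact_mod_cast hg
  induction k generalizing α with
  | zero => simpa using hc α
  | succ k ih =>
    rw [pow_succ', Module.End.mul_apply, subdivisionLin_apply]
    refine Finset.sum_eq_zero fun γ hγ => ?_
    unfold upsample
    split_ifs with hd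
    · obtain ⟨β', hβ'⟩ := hd
      rw [hβ', Int.mul_ediv_cancel_left _ (by omega), ih β', mul_zero]
      intro β hβ
      refine hc β ?_
      have h1 : (g : ℤ) ^ (k + 1) * β - α = g * ((g : ℤ) ^ k * β - β') - γ := by
        rw [mul_sub, ← hβ']
        ring
      have h2 : |(g : ℤ) * ((g : ℤ) ^ k * β - β')| ≤ g * (L * ((g : ℤ) ^ k - 1)) := by
        rw [abs_mul, abs_of_nonneg (by omega : (0 : ℤ) ≤ g)]
        exact mul_le_mul_of_nonneg_left hβ (by omega)
      have h3 := hL γ hγ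
      have h4 : (0 : ℤ) ≤ L := by positivity
      rw [h1]
      refine (abs_sub _ _).trans ?_
      have h5 : (L : ℤ) * ((g : ℤ) ^ (k + 1) - 1) =
        g * (L * ((g : ℤ) ^ k - 1)) + L * (g - 1) := by ring
      nlinarith
    · simp

theorem tendsto_floor_div_pow {g : ℕ} (hg : 2 ≤ g) (x : ℝ) :
    Tendsto (fun k : ℕ => ((⌊x * (g : ℝ) ^ k⌋ : ℤ) : ℝ) / (g : ℝ) ^ k) atTop (𝓝 x) := by
  have h : Tendsto (fun k : ℕ => x - ((g : ℝ) ^ k)⁻¹) atTop (𝓝 (x - 0)) :=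
    tendsto_const_nhds.sub
      (tendsto_pow_atTop_atTop_of_one_lt (by exact_mod_cast hg)).inv_tendsto_atTop
  rw [sub_zero] at h
  refine tendsto_of_tendsto_of_tendsto_of_le_of_le h tendsto_const_nhds (fun k => ?_) fun k => ?_
  all_goals have hpos : (0 : ℝ) < (g : ℝ) ^ k := by positivity
  · rw [le_div_iff₀ hpos, sub_mul, inv_mul_cancel₀ hpos.ne']
    exact (Int.sub_one_lt_floor _).le
  · rw [div_le_iff₀ hpos]
    exact Int.floor_le _

/-- The values of a limit function are limits of the subdivided data along every sequence of
`g`-adic points. -/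
theorem IsLimitFunction.tendsto {g : ℕ} (hg : 2 ≤ g) {p : ℤ →₀ ℝ} {c : ℤ → ℝ} {F : ℝ → ℝ}
    (hF : IsLimitFunction g p c F) {a : ℕ → ℤ} {x : ℝ}
    (ha : Tendsto (fun k => (a k : ℝ) / (g : ℝ) ^ k) atTop (𝓝 x)) :
    Tendsto (fun k => (subdivisionLin g p ^ k) c (a k)) atTop (𝓝 (F x)) := by
  have h1 : Tendsto (fun k => F ((a k : ℝ) / (g : ℝ) ^ k)) atTop (𝓝 (F x)) :=
    (hF.1.continuous.tendsto x).comp ha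
  refine h1.congr_dist ?_
  rw [Metric.tendsto_atTop]
  intro ε hε
  obtain ⟨K, hK⟩ := hF.2 (ε / 2) (by positivity)
  refine ⟨K, fun k hk => ?_⟩
  have h := hK k hk (a k)
  rw [subdivisionOp_iterate (by omega)] at h
  rw [Real.dist_eq, sub_zero, abs_of_nonneg dist_nonneg, Real.dist_eq]
  linarith

theorem exists_support_bound (p : ℤ →₀ ℝ) : ∃ L : ℕ, ∀ γ ∈ p.support, |γ| ≤ (L : ℤ) := by
  refine ⟨p.support.sup Int.natAbs, fun γ hγ => ?_⟩
  rw [Int.abs_eq_natAbs]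
  exact_mod_cast Finset.le_sup (f := Int.natAbs) hγ

/-- The basic limit function vanishes outside `[-L, L]`. -/
theorem IsLimitFunction.eq_zero_of_lt_abs {g : ℕ} (hg : 2 ≤ g) {p : ℤ →₀ ℝ} {φ : ℝ → ℝ}
    (hφ : IsLimitFunction g p delta φ) {L : ℕ} (hL : ∀ γ ∈ p.support, |γ| ≤ (L : ℤ)) {x : ℝ}
    (hx : (L : ℝ) < |x|) : φ x = 0 := by
  have h1 := tendsto_floor_div_pow hg x
  refine tendsto_nhds_unique (hφ.tendsto hg h1) (tendsto_const_nhds.congr' ?_)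
  filter_upwards [h1.abs.eventually (lt_mem_nhds hx)] with k hk
  symm
  refine subdivisionLin_pow_eq_zero hg hL k _ _ fun β hβ => ?_
  have hβ0 : β ≠ 0 := by
    rintro rfl
    rw [mul_zero, zero_sub, abs_neg] at hβ
    have hpos : (0 : ℝ) < (g : ℝ) ^ k := by positivity
    rw [abs_div, abs_of_pos hpos, lt_div_iff₀ hpos] at hk
    have h2 : (|((⌊x * (g : ℝ) ^ k⌋ : ℤ) : ℝ)|) ≤ L * ((g : ℝ) ^ k - 1) := by exact_mod_cast hβ
    have h3 : (0 : ℝ) ≤ L := by positivity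
    nlinarith
  simp [delta, hβ0]

theorem IsLimitFunction.finite_support_translate {g : ℕ} (hg : 2 ≤ g) {p : ℤ →₀ ℝ} {φ : ℝ → ℝ}
    (hφ : IsLimitFunction g p delta φ) (x : ℝ) :
    (Function.support fun α : ℤ => φ (x - α)).Finite := by
  obtain ⟨L, hL⟩ := exists_support_bound p
  refine (Set.finite_Icc ⌈x - L⌉ ⌊x + L⌋).subset fun α hα => ?_
  have h1 : |x - α| ≤ L := by
    by_contra! h
    exact hα (hφ.eq_zero_of_lt_abs hg hL h)
  rw [abs_le] at h1
  exact ⟨Int.ceil_le.2 (by linarith), Int.le_floor.2 (by linarith)⟩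

theorem subdivisionLin_delta {g : ℕ} (hg : g ≠ 0) (p : ℤ →₀ ℝ) :
    subdivisionLin g p delta = ∑ γ ∈ p.support, p γ • fun β => delta (β - γ) := by
  have hg' : (g : ℤ) ≠ 0 := by exact_mod_cast hg
  ext α
  rw [subdivisionLin_apply, Finset.sum_apply]
  refine Finset.sum_congr rfl fun γ _ => ?_
  simp only [Pi.smul_apply, smul_eq_mul]
  congr 1
  unfold upsample delta
  by_cases h : α - γ = 0
  · simp [h]
  · rw [Pi.single_eq_of_ne h]
    split_ifs with hd
    · obtain ⟨b, hb⟩ := hd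
      rw [hb, Int.mul_ediv_cancel_left _ hg', Pi.single_eq_of_ne]
      rintro rfl
      simp [hb] at h
    · rfl

/-- The refinement equation of the basic limit function. -/
theorem IsLimitFunction.refinement {g : ℕ} (hg : 2 ≤ g) {p : ℤ →₀ ℝ} {φ : ℝ → ℝ}
    (hφ : IsLimitFunction g p delta φ) (x : ℝ) :
    φ x = ∑ γ ∈ p.support, p γ * φ (g * x - γ) := by
  have h1 := tendsto_floor_div_pow hg x
  have h2 := (tendsto_add_atTop_iff_nat 1).2 (hφ.tendsto hg h1)
  refine tendsto_nhds_unique h2 ?_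
  have hg0 : (g : ℝ) ≠ 0 := by positivity
  have h3 : ∀ k : ℕ, (subdivisionLin g p ^ (k + 1)) delta ⌊x * (g : ℝ) ^ (k + 1)⌋ =
      ∑ γ ∈ p.support, p γ *
        (subdivisionLin g p ^ k) delta (⌊x * (g : ℝ) ^ (k + 1)⌋ - (g : ℤ) ^ k * γ) := by
    intro k
    rw [pow_succ, Module.End.mul_apply, subdivisionLin_delta (by omega), map_sum,
      Finset.sum_apply]
    refine Finset.sum_congr rfl fun γ _ => ?_
    rw [map_smul, Pi.smul_apply, smul_eq_mul, subdivisionLin_pow_shift (by omega)]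
  simp only [h3]
  refine tendsto_finsetSum _ fun γ _ => (hφ.tendsto hg ?_).const_mul _
  have h4 := (((tendsto_add_atTop_iff_nat 1).2 h1).const_mul (g : ℝ)).sub_const (γ : ℝ)
  refine h4.congr fun k => ?_
  have hpos : (g : ℝ) ^ k ≠ 0 := by positivity
  push_cast
  field_simp
  ring

/-- The basic limit function of a convergent scheme is not identically zero: by locality, every
limit function is locally a finite combination of integer translates of it. -/
theorem IsConvergent.exists_ne_zero {g : ℕ} (hg : 2 ≤ g) {p : ℤ →₀ ℝ} {φ : ℝ → ℝ}
    (hconv : IsConvergent g p) (hφ : IsLimitFunction g p delta φ) : ∃ x, φ x ≠ 0 := by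
  by_contra! h0
  obtain ⟨c, F, -, hF, x, hx⟩ := hconv.2
  obtain ⟨L, hL⟩ := exists_support_bound p
  apply hx
  have h1 := tendsto_floor_div_pow hg x
  obtain ⟨B, hB⟩ := exists_nat_gt (|x| + L)
  -- Near `x`, the subdivided data only depend on the entries of `c` with index in `[-B, B]`.
  set s : Finset ℤ := Finset.Icc (-(B : ℤ)) B
  set c' : ℤ → ℝ := ∑ β ∈ s, c β • fun α => delta (α - β) with hc'
  have hc'_eq : ∀ β ∈ s, c β = c' β := by
    intro β hβ
    rw [hc', Finset.sum_apply, Finset.sum_eq_single_of_mem β hβ]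
    · simp [delta]
    · intro b _ hb
      have : β - b ≠ 0 := sub_ne_zero.2 (Ne.symm hb)
      simp [delta, this]
  have h2 : Tendsto (fun k => (subdivisionLin g p ^ k) c' ⌊x * (g : ℝ) ^ k⌋) atTop (𝓝 0) := by
    have h3 : ∀ k : ℕ, (subdivisionLin g p ^ k) c' ⌊x * (g : ℝ) ^ k⌋ = ∑ β ∈ s, c β *
        (subdivisionLin g p ^ k) delta (⌊x * (g : ℝ) ^ k⌋ - (g : ℤ) ^ k * β) := by
      intro k
      rw [hc', map_sum, Finset.sum_apply]
      refine Finset.sum_congr rfl fun β _ => ?_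
      rw [map_smul, Pi.smul_apply, smul_eq_mul, subdivisionLin_pow_shift (by omega)]
    simp only [h3]
    have h4 : (0 : ℝ) = ∑ β ∈ s, c β * φ (x - β) := by simp [h0]
    rw [h4]
    refine tendsto_finsetSum _ fun β _ => (hφ.tendsto hg ?_).const_mul _
    refine (h1.sub_const (β : ℝ)).congr fun k => ?_
    have hpos : (g : ℝ) ^ k ≠ 0 := by positivity
    push_cast
    field_simp
  refine tendsto_nhds_unique (hF.tendsto hg h1) (h2.congr' ?_)
  have hlt : |x| < (B : ℝ) - L := by linarith
  filter_upwards [h1.abs.eventually (gt_mem_nhds hlt)] with k hk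
  symm
  rw [← sub_eq_zero, ← Pi.sub_apply, ← map_sub]
  refine subdivisionLin_pow_eq_zero hg hL k _ _ fun β hβ => ?_
  rw [Pi.sub_apply, sub_eq_zero]
  apply hc'_eq
  have hpos : (0 : ℝ) < (g : ℝ) ^ k := by positivity
  rw [abs_div, abs_of_pos hpos, div_lt_iff₀ hpos] at hk
  have h5 : |(g : ℝ) ^ k * β - ((⌊x * (g : ℝ) ^ k⌋ : ℤ) : ℝ)| ≤ L * ((g : ℝ) ^ k - 1) := by
    exact_mod_cast hβ
  have hL0 : (0 : ℝ) ≤ L := by positivity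
  have h6 : (g : ℝ) ^ k * |(β : ℝ)| ≤ (g : ℝ) ^ k * B := by
    rw [← abs_of_pos hpos, ← abs_mul, abs_of_pos hpos]
    have := abs_sub_abs_le_abs_sub ((g : ℝ) ^ k * β) ((⌊x * (g : ℝ) ^ k⌋ : ℤ) : ℝ)
    nlinarith
  have h7 : |β| ≤ (B : ℤ) := by exact_mod_cast le_of_mul_le_mul_left h6 hpos
  rw [abs_le] at h7
  exact Finset.mem_Icc.2 h7

/-! ### Combinations of the integer translates of the basic limit function -/

/-- The translation `c ↦ c(· + 1)` of sequences or functions. -/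
def shiftEnd (A : Type*) [AddGroupWithOne A] : Module.End ℂ (A → ℂ) :=
  LinearMap.funLeft ℂ ℂ fun x => x + 1

theorem shiftEnd_pow_apply {A : Type*} [AddGroupWithOne A] (n : ℕ) (c : A → ℂ) (x : A) :
    (shiftEnd A ^ n) c x = c (x + n) := by
  induction n generalizing x with
  | zero => simp
  | succ n ih =>
    rw [pow_succ', Module.End.mul_apply]
    change (shiftEnd A ^ n) c (x + 1) = _
    rw [ih, add_assoc, Nat.cast_add, Nat.cast_one, ← Nat.cast_one, ← Nat.cast_add,
      ← Nat.cast_add, add_comm 1 n]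

theorem aeval_shiftEnd_apply {A : Type*} [AddGroupWithOne A] (Q : ℂ[X]) (c : A → ℂ) (x : A) :
    aeval (shiftEnd A) Q c x = Q.sum fun n q => q * c (x + n) := by
  rw [aeval_eq_sum_range, LinearMap.sum_apply, Finset.sum_apply,
    Q.sum_over_range (fun n => by simp)]
  simp [shiftEnd_pow_apply]

theorem aeval_X_sub_one_pow_shiftEnd {A : Type*} [AddCommGroupWithOne A] (n : ℕ) (c : A → ℂ) :
    aeval (shiftEnd A) ((X - 1 : ℂ[X]) ^ n) c = (fwdDiff (1 : A))^[n] c := by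
  rw [map_pow, Module.End.pow_apply]
  congr 1
  ext c x
  simp [shiftEnd, fwdDiff, LinearMap.funLeft]

theorem summable_mul_translate {φ : ℝ → ℝ}
    (hφ : ∀ x : ℝ, (Function.support fun α : ℤ => φ (x - α)).Finite) (c : ℤ → ℂ) (x : ℝ) :
    Summable fun α : ℤ => c α * (φ (x - α) : ℂ) := by
  refine summable_of_hasFiniteSupport ((hφ x).subset fun α hα => ?_)
  simp only [Function.mem_support, ne_eq, mul_eq_zero, not_or, Complex.ofReal_eq_zero] at hα ⊢
  exact hα.2

/-- The linear map `c ↦ ∑_α c_α φ(· - α)` from sequences to functions, for a function `φ` such that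
these sums are finite. -/
def translateComb (φ : ℝ → ℝ) (hφ : ∀ x : ℝ, (Function.support fun α : ℤ => φ (x - α)).Finite) :
    (ℤ → ℂ) →ₗ[ℂ] (ℝ → ℂ) where
  toFun c x := ∑' α : ℤ, c α * (φ (x - α) : ℂ)
  map_add' c c' := by
    ext x
    simp only [Pi.add_apply, add_mul]
    exact (summable_mul_translate hφ c x).tsum_add (summable_mul_translate hφ c' x)
  map_smul' t c := by
    ext x
    simp only [Pi.smul_apply, smul_eq_mul, RingHom.id_apply, mul_assoc]
    exact tsum_mul_left

variable {φ : ℝ → ℝ} {hφ : ∀ x : ℝ, (Function.support fun α : ℤ => φ (x - α)).Finite}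

theorem translateComb_apply (c : ℤ → ℂ) (x : ℝ) :
    translateComb φ hφ c x = ∑' α : ℤ, c α * (φ (x - α) : ℂ) := rfl

theorem translateComb_comp_add (c : ℤ → ℂ) (a : ℤ) (x : ℝ) :
    translateComb φ hφ (fun α => c (α + a)) x = translateComb φ hφ c (x + a) := by
  rw [translateComb_apply, translateComb_apply,
    ← (Equiv.addRight a).tsum_eq fun α : ℤ => c α * (φ (x + a - α) : ℂ)]
  refine tsum_congr fun α => ?_
  simp

theorem translateComb_aeval (Q : ℂ[X]) (c : ℤ → ℂ) :
    translateComb φ hφ (aeval (shiftEnd ℤ) Q c) = aeval (shiftEnd ℝ) Q (translateComb φ hφ c) := by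
  ext x
  rw [aeval_eq_sum_range, aeval_eq_sum_range, LinearMap.sum_apply, map_sum, LinearMap.sum_apply,
    Finset.sum_apply, Finset.sum_apply]
  refine Finset.sum_congr rfl fun n _ => ?_
  rw [LinearMap.smul_apply, LinearMap.smul_apply, map_smul, Pi.smul_apply, Pi.smul_apply,
    shiftEnd_pow_apply]
  have : (shiftEnd ℤ ^ n) c = fun α => c (α + (n : ℤ)) := by
    ext α
    exact_mod_cast shiftEnd_pow_apply n c α
  rw [this, translateComb_comp_add]
  simp

theorem aeval_mem_ker (Q : ℂ[X]) {c : ℤ → ℂ} (hc : translateComb φ hφ c = 0) :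
    translateComb φ hφ (aeval (shiftEnd ℤ) Q c) = 0 := by
  rw [translateComb_aeval, hc, map_zero]

/-- The symbol `∑_α p_α z^α` of a mask, as a function of `z`. -/
def maskSymbol (p : ℤ →₀ ℝ) (z : ℂ) : ℂ := ∑ γ ∈ p.support, (p γ : ℂ) * z ^ γ

/-- The symbol of a mask supported in `[-L, L]`, multiplied by `X ^ L` so that it is a
polynomial. -/
def maskPoly (p : ℤ →₀ ℝ) (L : ℕ) : ℂ[X] :=
  ∑ γ ∈ p.support, C (p γ : ℂ) * X ^ (γ + L).toNat

theorem maskPoly_eval {p : ℤ →₀ ℝ} {L : ℕ} (hL : ∀ γ ∈ p.support, |γ| ≤ (L : ℤ)) {z : ℂ}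
    (hz : z ≠ 0) : (maskPoly p L).eval z = z ^ L * maskSymbol p z := by
  rw [maskPoly, maskSymbol, eval_finsetSum, Finset.mul_sum]
  refine Finset.sum_congr rfl fun γ hγ => ?_
  have h := abs_le.1 (hL γ hγ)
  rw [eval_mul, eval_C, eval_pow, eval_X, ← zpow_natCast z (γ + L).toNat,
    Int.toNat_of_nonneg (by omega), zpow_add₀ hz, zpow_natCast]
  ring

theorem aeval_maskPoly_apply {p : ℤ →₀ ℝ} {L : ℕ} (hL : ∀ γ ∈ p.support, |γ| ≤ (L : ℤ))
    (c : ℤ → ℂ) :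
    aeval (shiftEnd ℤ) (maskPoly p L) c =
      ∑ γ ∈ p.support, (p γ : ℂ) • fun α => c (α + (γ + L)) := by
  rw [maskPoly, map_sum, LinearMap.sum_apply]
  refine Finset.sum_congr rfl fun γ hγ => ?_
  have h := abs_le.1 (hL γ hγ)
  ext α
  have h' : (((γ + L).toNat : ℕ) : ℤ) = γ + L := Int.toNat_of_nonneg (by omega)
  rw [map_mul, map_pow, aeval_X, aeval_C, Module.End.mul_apply, Module.algebraMap_end_apply,
    Pi.smul_apply, Pi.smul_apply, shiftEnd_pow_apply, ← h']
  simp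

theorem translateComb_upsample {g : ℕ} (hg : g ≠ 0) (c : ℤ → ℂ) (y : ℝ) :
    translateComb φ hφ (upsample g c) y = ∑' β : ℤ, c β * (φ (y - g * β) : ℂ) := by
  have hg' : (g : ℤ) ≠ 0 := by exact_mod_cast hg
  have hinj : Function.Injective fun β : ℤ => (g : ℤ) * β := fun β β' h => mul_left_cancel₀ hg' h
  rw [translateComb_apply, ← hinj.tsum_eq]
  · refine tsum_congr fun β => ?_
    rw [upsample_mul hg]
    push_cast
    rfl
  · intro α hα
    by_contra h
    apply hα
    have : ¬ (g : ℤ) ∣ α := fun ⟨β, hβ⟩ => h ⟨β, hβ.symm⟩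
    simp [upsample, this]

/-- The refinement equation for combinations of translates: one step of the subdivision scheme
(upsampling followed by the filter given by the mask) corresponds to a dilation by `g`. -/
theorem translateComb_maskPoly_upsample {g : ℕ} (hg : g ≠ 0) {p : ℤ →₀ ℝ} {L : ℕ}
    (hL : ∀ γ ∈ p.support, |γ| ≤ (L : ℤ)) (hsymm : ∀ α : ℤ, p (-α) = p α)
    (href : ∀ x, φ x = ∑ γ ∈ p.support, p γ * φ (g * x - γ)) (c : ℤ → ℂ) (y : ℝ) :
    translateComb φ hφ (aeval (shiftEnd ℤ) (maskPoly p L) (upsample g c)) y =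
      translateComb φ hφ c ((y + L) / g) := by
  have hg' : (g : ℝ) ≠ 0 := by exact_mod_cast hg
  have href' : ∀ x, φ x = ∑ γ ∈ p.support, p γ * φ (g * x + γ) := by
    intro x
    rw [href x]
    refine Finset.sum_equiv (Equiv.neg ℤ) (fun γ => ?_) fun γ _ => ?_
    · simp [hsymm]
    · simp [hsymm, sub_eq_add_neg]
  rw [aeval_maskPoly_apply hL, map_sum, Finset.sum_apply]
  have h1 : ∀ γ ∈ p.support, (translateComb φ hφ ((p γ : ℂ) •
      fun α => upsample g c (α + (γ + L)))) y =
      ∑' β : ℤ, c β * ((p γ * φ (y + (γ + L) - g * β) : ℝ) : ℂ) := by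
    intro γ _
    rw [map_smul, Pi.smul_apply, translateComb_comp_add, translateComb_upsample hg, smul_eq_mul,
      ← tsum_mul_left]
    refine tsum_congr fun β => ?_
    push_cast
    ring
  rw [Finset.sum_congr rfl h1, ← Summable.tsum_finsetSum, translateComb_apply]
  · refine tsum_congr fun β => ?_
    rw [← Finset.mul_sum, href' ((y + L) / g - β), ← Complex.ofReal_sum]
    congr 4
    ext γ
    congr 2
    field_simp
    ring
  · intro γ _
    have hinj : Function.Injective fun β : ℤ => (g : ℤ) * β :=
      fun β β' h => mul_left_cancel₀ (by exact_mod_cast hg) h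
    refine summable_of_hasFiniteSupport (((hφ (y + (γ + L))).preimage hinj.injOn).subset
      fun β hβ => ?_)
    simp only [Function.mem_support, ne_eq, mul_eq_zero, not_or, Complex.ofReal_eq_zero] at hβ
    simpa using hβ.2.2

/-! ### Exponential sequences in the kernel -/

theorem aeval_zpow (Q : ℂ[X]) {z : ℂ} (hz : z ≠ 0) :
    aeval (shiftEnd ℤ) Q (fun α : ℤ => z ^ α) = Q.eval z • fun α : ℤ => z ^ α := by
  ext α
  rw [aeval_shiftEnd_apply, eval_eq_sum, Pi.smul_apply, smul_eq_mul, Polynomial.sum,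
    Polynomial.sum, Finset.sum_mul]
  refine Finset.sum_congr rfl fun n _ => ?_
  rw [zpow_add₀ hz, zpow_natCast]
  ring

/-- The polynomial `(X ^ g - z ^ g) / (X - z)`. -/
def geomQuotient (g : ℕ) (z : ℂ) : ℂ[X] := ∑ i ∈ Finset.range g, X ^ i * C z ^ (g - 1 - i)

theorem geomQuotient_mul (g : ℕ) (z : ℂ) : geomQuotient g z * (X - C z) = X ^ g - C (z ^ g) := by
  rw [geomQuotient, C_pow]
  exact (Commute.all _ _).geom_sum₂_mul g

/-- Upsampling the exponential of `z ^ g` yields a combination of the exponentials of the `g`-th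
roots of `z ^ g`; the polynomial `(X ^ g - z ^ g) / (X - z)` of the translation isolates that
of `z`. -/
theorem aeval_geomQuotient_upsample {g : ℕ} (hg : g ≠ 0) {z : ℂ} (hz : z ≠ 0) :
    aeval (shiftEnd ℤ) (geomQuotient g z) (upsample g fun α : ℤ => (z ^ g) ^ α) =
      z ^ (g - 1) • fun α : ℤ => z ^ α := by
  have hg' : (0 : ℤ) < g := by exact_mod_cast Nat.pos_of_ne_zero hg
  ext α
  rw [geomQuotient, map_sum, LinearMap.sum_apply, Finset.sum_apply]
  have h1 : ∀ i ∈ Finset.range g, (aeval (shiftEnd ℤ) (X ^ i * C z ^ (g - 1 - i) : ℂ[X]))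
      (upsample g fun α : ℤ => (z ^ g) ^ α) α =
      if i = ((-α) % g).toNat then z ^ (g - 1) * z ^ α else 0 := by
    intro i hi
    rw [Finset.mem_range] at hi
    rw [mul_comm, ← C_pow, map_mul, aeval_C, Module.End.mul_apply, Module.algebraMap_end_apply,
      map_pow, aeval_X, Pi.smul_apply, shiftEnd_pow_apply, smul_eq_mul]
    have h0 : 0 ≤ (-α) % g := Int.emod_nonneg _ hg'.ne'
    have hlt : (-α) % g < g := Int.emod_lt_of_pos _ hg'
    have hiff : (g : ℤ) ∣ α + (i : ℤ) ↔ i = ((-α) % g).toNat := by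
      constructor
      · rintro ⟨b, hb⟩
        have h2 : (i : ℤ) = -α + g * b := by rw [← hb]; ring
        have h3 : (i : ℤ) % g = (-α) % g := by rw [h2, Int.add_mul_emod_self_left]
        rw [Int.emod_eq_of_lt (by omega) (by omega)] at h3
        omega
      · intro h2
        refine ⟨-((-α) / g), ?_⟩
        have h3 := Int.emod_add_mul_ediv (-α) g
        have h4 : (i : ℤ) = (-α) % g := by omega
        rw [h4]
        linarith
    by_cases h : (g : ℤ) ∣ α + (i : ℤ)
    · rw [if_pos (hiff.1 h)]
      obtain ⟨b, hb⟩ := h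
      rw [hb, upsample_mul hg, ← zpow_natCast z g, ← zpow_mul, ← hb,
        ← zpow_natCast z (g - 1 - i), ← zpow_natCast z (g - 1), ← zpow_add₀ hz, ← zpow_add₀ hz]
      congr 1
      omega
    · rw [if_neg (fun h' => h (hiff.2 h')), upsample, if_neg h, mul_zero]
  rw [Finset.sum_congr rfl h1, Finset.sum_ite_eq', if_pos]
  · rfl
  · have hlt : (-α) % g < g := Int.emod_lt_of_pos _ hg'
    have h0 : 0 ≤ (-α) % g := Int.emod_nonneg _ hg'.ne'
    rw [Finset.mem_range]
    omega

/-- If the exponential of `z ^ g` is annihilated and the symbol does not vanish at `z`, then the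
exponential of `z` is annihilated. -/
theorem translateComb_zpow_eq_zero {g : ℕ} (hg : g ≠ 0) {p : ℤ →₀ ℝ}
    (hsymm : ∀ α : ℤ, p (-α) = p α)
    (href : ∀ x, φ x = ∑ γ ∈ p.support, p γ * φ (g * x - γ)) {z : ℂ} (hz : z ≠ 0)
    (hpz : maskSymbol p z ≠ 0) (h : translateComb φ hφ (fun α => (z ^ g) ^ α) = 0) :
    translateComb φ hφ (fun α => z ^ α) = 0 := by
  obtain ⟨L, hL⟩ := exists_support_bound p
  have h1 : translateComb φ hφ (aeval (shiftEnd ℤ) (maskPoly p L)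
      (upsample g fun α : ℤ => (z ^ g) ^ α)) = 0 := by
    ext y
    rw [translateComb_maskPoly_upsample hg hL hsymm href, h]
    rfl
  have h2 := aeval_mem_ker (geomQuotient g z) h1
  rw [← Module.End.mul_apply, ← map_mul, mul_comm, map_mul, Module.End.mul_apply,
    aeval_geomQuotient_upsample hg hz, map_smul, aeval_zpow _ hz, map_smul, map_smul,
    maskPoly_eval hL hz] at h2
  have h3 : z ^ (g - 1) ≠ 0 := pow_ne_zero _ hz
  have h4 : z ^ L * maskSymbol p z ≠ 0 := mul_ne_zero (pow_ne_zero _ hz) hpz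
  exact (smul_eq_zero_iff_right h4).1 ((smul_eq_zero_iff_right h3).1 h2)

theorem maskPoly_ne_zero {q : ℤ →₀ ℝ} {L : ℕ} (hL : ∀ γ ∈ q.support, |γ| ≤ (L : ℤ))
    (hq : q 0 ≠ 0) : maskPoly q L ≠ 0 := by
  intro h
  have h1 : (maskPoly q L).coeff L = (q 0 : ℂ) := by
    rw [maskPoly, finsetSum_coeff, Finset.sum_eq_single_of_mem 0 (by simpa using hq)]
    · simp
    · intro γ hγ hγ0
      have := abs_le.1 (hL γ hγ)
      rw [coeff_C_mul, coeff_X_pow, if_neg (by omega), mul_zero]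
  rw [h, coeff_zero] at h1
  exact hq (by exact_mod_cast h1.symm)

/-- Only finitely many exponential sequences are annihilated: for fixed `x` with `φ x ≠ 0`, the
value of the combination at `x` is a nonzero Laurent polynomial in `z`. -/
theorem finite_setOf_translateComb_zpow_eq_zero {x : ℝ} (hx : φ x ≠ 0) :
    {z : ℂ | z ≠ 0 ∧ translateComb φ hφ (fun α => z ^ α) = 0}.Finite := by
  set q : ℤ →₀ ℝ := Finsupp.ofSupportFinite (fun α : ℤ => φ (x - α)) (hφ x) with hq
  have hqa : ∀ α : ℤ, q α = φ (x - α) := fun α => rfl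
  obtain ⟨M, hM⟩ := exists_support_bound q
  have h0 : maskPoly q M ≠ 0 := maskPoly_ne_zero hM (by simpa [hqa] using hx)
  refine (maskPoly q M).roots.toFinset.finite_toSet.subset fun z ⟨hz, hz'⟩ => ?_
  rw [Finset.mem_coe, Multiset.mem_toFinset, mem_roots h0, IsRoot.def, maskPoly_eval hM hz]
  have h1 := congrFun hz' x
  rw [translateComb_apply, tsum_eq_sum (s := q.support)] at h1
  · rw [maskSymbol]
    have h2 : ∑ γ ∈ q.support, (q γ : ℂ) * z ^ γ = 0 :=
      (Finset.sum_congr rfl fun γ _ => mul_comm _ _).trans h1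
    rw [h2, mul_zero]
  · intro α hα
    rw [Finsupp.notMem_support_iff, hqa] at hα
    simp [hα]

/-- If every `g`-adic root of unity has a `g`-th root at which the symbol does not vanish, then no
exponential sequence of a `g`-adic root of unity `z ≠ 1` is annihilated: otherwise the finite set
of such `z` would be contained in, hence equal to, its image under `z ↦ z ^ g`, although iterating
this map leads to `1`. -/
theorem translateComb_zpow_ne_zero {g : ℕ} (hg : g ≠ 0) {p : ℤ →₀ ℝ}
    (hsymm : ∀ α : ℤ, p (-α) = p α)
    (href : ∀ x, φ x = ∑ γ ∈ p.support, p γ * φ (g * x - γ)) (hne : ∃ x, φ x ≠ 0)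
    (hroot : ∀ (k : ℕ) (z : ℂ), z ^ g ^ k = 1 → ∃ w : ℂ, w ^ g = z ∧ maskSymbol p w ≠ 0)
    {k : ℕ} {z : ℂ} (hz1 : z ≠ 1) (hz : z ^ g ^ k = 1) :
    translateComb φ hφ (fun α => z ^ α) ≠ 0 := by
  intro h
  obtain ⟨x, hx⟩ := hne
  have hfin : {z : ℂ | (z ≠ 0 ∧ translateComb φ hφ (fun α => z ^ α) = 0) ∧ z ≠ 1 ∧
      ∃ k : ℕ, z ^ g ^ k = 1}.Finite :=
    (finite_setOf_translateComb_zpow_eq_zero (hφ := hφ) hx).subset fun z hz => hz.1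
  set F := hfin.toFinset with hF
  have hne0 : ∀ {w : ℂ} {k : ℕ}, w ^ g ^ k = 1 → w ≠ 0 := by
    rintro w k hw rfl
    rw [zero_pow (pow_ne_zero _ hg)] at hw
    exact zero_ne_one hw
  have hsub : F ⊆ F.image (· ^ g) := by
    intro w hw
    obtain ⟨⟨hw0, hw1⟩, hw2, j, hj⟩ := hfin.mem_toFinset.1 hw
    obtain ⟨v, hv, hpv⟩ := hroot j w hj
    have hvj : v ^ g ^ (j + 1) = 1 := by rw [pow_succ', pow_mul, hv, hj]
    refine Finset.mem_image.2 ⟨v, hfin.mem_toFinset.2 ⟨⟨hne0 hvj, ?_⟩, ?_, j + 1, hvj⟩, hv⟩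
    · exact translateComb_zpow_eq_zero hg hsymm href (hne0 hvj) hpv (by rw [hv]; exact hw1)
    · rintro rfl
      exact hw2 (by rw [← hv, one_pow])
  have hEq : F = F.image (· ^ g) := Finset.eq_of_subset_of_card_le hsub Finset.card_image_le
  have hstep : ∀ w ∈ F, w ^ g ∈ F := by
    intro w hw
    rw [hEq]
    exact Finset.mem_image_of_mem _ hw
  have hiter : ∀ j : ℕ, z ^ g ^ j ∈ F := by
    intro j
    induction j with
    | zero =>
      rw [pow_zero, pow_one]
      exact hfin.mem_toFinset.2 ⟨⟨hne0 hz, h⟩, hz1, k, hz⟩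
    | succ j ih =>
      rw [pow_succ, pow_mul]
      exact hstep _ ih
  exact (hfin.mem_toFinset.1 (hiter k)).2.1 hz

/-! ### Zeros of the symbol from polynomial generation -/

theorem aeval_upsample {g : ℕ} (hg : g ≠ 0) (n : ℕ) (c : ℤ → ℂ) :
    aeval (shiftEnd ℤ) ((X ^ g - 1 : ℂ[X]) ^ n) (upsample g c) =
      upsample g (aeval (shiftEnd ℤ) ((X - 1 : ℂ[X]) ^ n) c) := by
  have hg' : (g : ℤ) ≠ 0 := by exact_mod_cast hg
  induction n generalizing c with
  | zero => simp
  | succ n ih =>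
    rw [pow_succ, map_mul, Module.End.mul_apply, pow_succ, map_mul, Module.End.mul_apply, ← ih]
    congr 1
    ext α
    have h1 : (g : ℤ) ∣ α + g ↔ (g : ℤ) ∣ α := by simp
    simp only [map_sub, map_pow, aeval_X, map_one, LinearMap.sub_apply, Pi.sub_apply,
      shiftEnd_pow_apply, Module.End.one_apply]
    unfold upsample
    simp only [h1]
    split_ifs with hd
    · obtain ⟨b, rfl⟩ := hd
      rw [show (g : ℤ) * b + g = g * (b + 1) by ring, Int.mul_ediv_cancel_left _ hg',
        Int.mul_ediv_cancel_left _ hg']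
      rfl
    · simp

/-- Polynomial generation, in the form needed here: the finite differences of order `d + 1` of
the combination of translates with coefficients `α ^ d` vanish after one subdivision step. -/
theorem translateComb_aeval_upsample_pow_eq_zero {g : ℕ} (hg : g ≠ 0) {p : ℤ →₀ ℝ} {L : ℕ}
    (hL : ∀ γ ∈ p.support, |γ| ≤ (L : ℤ)) (hsymm : ∀ α : ℤ, p (-α) = p α)
    (href : ∀ x, φ x = ∑ γ ∈ p.support, p γ * φ (g * x - γ)) {d : ℕ}
    (hgen : ∀ q : ℝ[X], q.natDegree ≤ d → ∃ r : ℝ[X], r.natDegree ≤ d ∧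
      ∀ t : ℝ, HasSum (fun α : ℤ => q.eval (α : ℝ) * φ (t - α)) (r.eval t)) :
    translateComb φ hφ (aeval (shiftEnd ℤ) ((X - 1 : ℂ[X]) ^ (d + 1))
      (aeval (shiftEnd ℤ) (maskPoly p L) (upsample g fun α : ℤ => (α : ℂ) ^ d))) = 0 := by
  obtain ⟨r, hr, hsum⟩ := hgen (X ^ d) (natDegree_X_pow_le d)
  set R : ℂ[X] := (r.map Complex.ofRealHom).comp (C ((g : ℂ)⁻¹) * X + C ((L : ℂ) / g)) with hR
  have hRdeg : R.natDegree < d + 1 := by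
    refine Nat.lt_succ_of_le ((natDegree_comp_le).trans ?_)
    have h1 : (C ((g : ℂ)⁻¹) * X + C ((L : ℂ) / g)).natDegree ≤ 1 := natDegree_linear_le
    have h2 : (r.map Complex.ofRealHom).natDegree ≤ d := natDegree_map_le.trans hr
    calc _ ≤ d * 1 := Nat.mul_le_mul h2 h1
      _ = d := mul_one d
  have hval : ∀ t : ℝ, translateComb φ hφ (fun α : ℤ => (α : ℂ) ^ d) t = (r.eval t : ℝ) := by
    intro t
    rw [← (hsum t).tsum_eq, Complex.ofReal_tsum, translateComb_apply]
    refine tsum_congr fun α => ?_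
    simp
  have h1 : translateComb φ hφ (aeval (shiftEnd ℤ) (maskPoly p L)
      (upsample g fun α : ℤ => (α : ℂ) ^ d)) = fun y : ℝ => R.eval (y : ℂ) := by
    ext y
    rw [translateComb_maskPoly_upsample hg hL hsymm href, hval, hR, eval_comp]
    have h2 : (C ((g : ℂ)⁻¹) * X + C ((L : ℂ) / g)).eval (y : ℂ) =
        Complex.ofRealHom ((y + L) / g) := by
      simp
      ring
    rw [h2, eval_map_apply]
    rfl
  have h3 : aeval (shiftEnd ℂ) ((X - 1 : ℂ[X]) ^ (d + 1)) (fun y : ℂ => R.eval y) = 0 := by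
    rw [aeval_X_sub_one_pow_shiftEnd]
    exact fwdDiff_iter_eq_zero_of_degree_lt hRdeg
  rw [translateComb_aeval, h1]
  ext y
  have h4 := congrFun h3 (y : ℂ)
  rw [aeval_shiftEnd_apply] at h4 ⊢
  simpa using h4

/-- The symbol has a zero of order at least `d + 1` at every `g`-th root of unity `ω ≠ 1`.
Otherwise, a suitable polynomial of the translation maps a sequence that is annihilated by
polynomial generation to a nonzero multiple of `α ↦ ω ^ α`. -/
theorem pow_dvd_maskPoly {g : ℕ} (hg : g ≠ 0) {p : ℤ →₀ ℝ} {L : ℕ}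
    (hL : ∀ γ ∈ p.support, |γ| ≤ (L : ℤ)) (hsymm : ∀ α : ℤ, p (-α) = p α)
    (href : ∀ x, φ x = ∑ γ ∈ p.support, p γ * φ (g * x - γ)) {d : ℕ}
    (hgen : ∀ q : ℝ[X], q.natDegree ≤ d → ∃ r : ℝ[X], r.natDegree ≤ d ∧
      ∀ t : ℝ, HasSum (fun α : ℤ => q.eval (α : ℝ) * φ (t - α)) (r.eval t))
    {ω : ℂ} (hω : ω ^ g = 1) (hω1 : ω ≠ 1)
    (hker : translateComb φ hφ (fun α => ω ^ α) ≠ 0) :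
    (X - C ω) ^ (d + 1) ∣ maskPoly p L := by
  have hω0 : ω ≠ 0 := by
    rintro rfl
    rw [zero_pow hg] at hω
    exact zero_ne_one hω
  by_cases hP0 : maskPoly p L = 0
  · rw [hP0]
    exact dvd_zero _
  obtain ⟨Q, hPQ, hQ⟩ := exists_eq_pow_rootMultiplicity_mul_and_not_dvd (maskPoly p L) hP0 ω
  set r := (maskPoly p L).rootMultiplicity ω with hr
  by_contra hdvd
  have hrd : r ≤ d := by
    by_contra! h
    exact hdvd ((pow_dvd_pow _ h).trans (Dvd.intro _ hPQ.symm))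
  have hG : geomQuotient g ω * (X - C ω) = X ^ g - 1 := by rw [geomQuotient_mul, hω, C_1]
  obtain ⟨E, hE⟩ : X - C 1 ∣ geomQuotient g ω := by
    rw [dvd_iff_isRoot, IsRoot.def]
    have h1 := congrArg (eval 1) hG
    rw [eval_mul] at h1
    simp only [eval_sub, eval_X, eval_C, eval_pow, eval_one, one_pow, sub_self] at h1
    exact (mul_eq_zero.1 h1).resolve_right (sub_ne_zero.2 (Ne.symm hω1))
  rw [C_1] at hE
  -- With `X ^ g - 1 = (X - 1) * (X - ω) * E`, this multiplier completes the annihilating factors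
  -- `(X - 1) ^ (d + 1)` and `(X - ω) ^ r` to `(X ^ g - 1) ^ d`, which takes the upsampled `α ^ d` to
  -- the upsampled constant `d!`, times `(X ^ g - 1) / (X - ω)`, which isolates `α ↦ ω ^ α`.
  have h1 := aeval_mem_ker ((X - C ω) ^ (d - r) * E ^ (d + 1))
    (translateComb_aeval_upsample_pow_eq_zero (hφ := hφ) hg hL hsymm href hgen)
  have h2 : (X - C ω) ^ (d - r) * E ^ (d + 1) * ((X - 1) ^ (d + 1) * maskPoly p L) =
      Q * (geomQuotient g ω * (X ^ g - 1) ^ d) := by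
    rw [hPQ, ← hG, hE]
    obtain ⟨e, rfl⟩ := Nat.exists_eq_add_of_le hrd
    rw [Nat.add_sub_cancel_left]
    simp only [mul_pow]
    ring
  have h3 : (aeval (shiftEnd ℤ) ((X - 1 : ℂ[X]) ^ d)) (fun α : ℤ => (α : ℂ) ^ d) =
      (d.factorial : ℂ) • fun α : ℤ => (ω ^ g) ^ α := by
    have h4 := fwdDiff_iter_eq_factorial (R := ℂ) (n := d)
    rw [← aeval_X_sub_one_pow_shiftEnd] at h4
    ext α
    have h5 := congrFun h4 (α : ℂ)
    rw [aeval_shiftEnd_apply] at h5 ⊢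
    simpa [hω] using h5
  have h6 : upsample g ((d.factorial : ℂ) • fun α : ℤ => (ω ^ g) ^ α) =
      (d.factorial : ℂ) • upsample g fun α : ℤ => (ω ^ g) ^ α := by
    ext α
    rw [Pi.smul_apply]
    unfold upsample
    split_ifs <;> simp
  rw [← Module.End.mul_apply, ← Module.End.mul_apply, ← map_mul, ← map_mul, mul_assoc,
    h2, map_mul, map_mul, Module.End.mul_apply, Module.End.mul_apply, aeval_upsample hg, h3, h6,
    map_smul, aeval_geomQuotient_upsample hg hω0, map_smul, map_smul, map_smul, aeval_zpow _ hω0,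
    map_smul, map_smul] at h1
  have hQ' : Q.eval ω ≠ 0 := fun h => hQ (dvd_iff_isRoot.2 h)
  have hf : (d.factorial : ℂ) ≠ 0 := by exact_mod_cast d.factorial_ne_zero
  exact hker ((smul_eq_zero_iff_right hQ').1 ((smul_eq_zero_iff_right (pow_ne_zero _ hω0)).1
    ((smul_eq_zero_iff_right hf).1 h1)))

/-! ### Discrete Fourier analysis of circulant matrices -/

/-- The discrete Fourier transform of a vector, as the function `z ↦ ∑_r x_r z^r` on the `n`-th roots
of unity. -/
def fourierSum {n : ℕ} (x : Fin n → ℂ) (z : ℂ) : ℂ := ∑ r, x r * z ^ (r : ℕ)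

/-- The Laurent polynomial `∑_j a_j z^j`. -/
def laurentEval (a : ℤ →₀ ℂ) (z : ℂ) : ℂ := a.sum fun j c => c * z ^ j

theorem trigPoly_eq_laurentEval (a : ℤ →₀ ℂ) (x : ℝ) :
    trigPoly a x = laurentEval a (Complex.exp (x * Complex.I)) := by
  refine Finset.sum_congr rfl fun j _ => ?_
  dsimp only
  rw [← Complex.exp_int_mul]
  congr 2
  ring

theorem laurentEval_maskCoeff (p : ℤ →₀ ℝ) (z : ℂ) :
    laurentEval (maskCoeff p) z = maskSymbol p z := by
  rw [laurentEval, maskCoeff, Finsupp.sum_mapRange_index (by simp)]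
  rfl

theorem ne_zero_of_mem_nthRootsFinset {n : ℕ} (hn : 0 < n) {z : ℂ}
    (hz : z ∈ nthRootsFinset n (1 : ℂ)) : z ≠ 0 := by
  rintro rfl
  rw [mem_nthRootsFinset hn, zero_pow hn.ne'] at hz
  exact zero_ne_one hz

theorem norm_of_mem_nthRootsFinset {n : ℕ} (hn : 0 < n) {z : ℂ}
    (hz : z ∈ nthRootsFinset n (1 : ℂ)) : ‖z‖ = 1 :=
  Complex.norm_eq_one_of_pow_eq_one ((mem_nthRootsFinset hn _).1 hz) hn.ne'

theorem sum_nthRootsFinset_zpow {n : ℕ} (hn : 0 < n) (l : ℤ) :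
    ∑ z ∈ nthRootsFinset n (1 : ℂ), z ^ l = if (n : ℤ) ∣ l then (n : ℂ) else 0 := by
  have hζ := Complex.isPrimitiveRoot_exp n hn.ne'
  set ζ := Complex.exp (2 * Real.pi * Complex.I / n)
  split_ifs with h
  · obtain ⟨b, rfl⟩ := h
    rw [Finset.sum_congr rfl (g := fun _ => (1 : ℂ)), Finset.sum_const, hζ.card_nthRootsFinset,
      nsmul_eq_mul, mul_one]
    intro z hz
    rw [zpow_mul, zpow_natCast, (mem_nthRootsFinset hn _).1 hz, one_zpow]
  · have hζ0 : ζ ≠ 0 := Complex.exp_ne_zero _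
    have h1 : ∑ z ∈ nthRootsFinset n (1 : ℂ), z ^ l =
        ∑ z ∈ nthRootsFinset n (1 : ℂ), (ζ * z) ^ l := by
      symm
      refine Finset.sum_bij (fun z _ => ζ * z) (fun z hz => ?_)
        (fun z _ w _ h => mul_left_cancel₀ hζ0 h) (fun z hz => ⟨ζ⁻¹ * z, ?_, ?_⟩) fun _ _ => rfl
      · rw [mem_nthRootsFinset hn] at hz ⊢
        rw [mul_pow, hζ.pow_eq_one, hz, mul_one]
      · rw [mem_nthRootsFinset hn] at hz ⊢
        rw [mul_pow, inv_pow, hζ.pow_eq_one, hz, inv_one, mul_one]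
      · rw [mul_inv_cancel_left₀ hζ0]
    have h2 : ζ ^ l ≠ 1 := fun h' => h ((hζ.zpow_eq_one_iff_dvd l).1 h')
    simp only [mul_zpow, ← Finset.mul_sum] at h1
    have h3 : (ζ ^ l - 1) * ∑ z ∈ nthRootsFinset n (1 : ℂ), z ^ l = 0 := by
      rw [sub_mul, ← h1, one_mul, sub_self]
    exact (mul_eq_zero.1 h3).resolve_left (sub_ne_zero.2 h2)

/-- Parseval's identity. -/
theorem sum_star_fourierSum_mul {n : ℕ} (hn : 0 < n) (x y : Fin n → ℂ) :
    ∑ z ∈ nthRootsFinset n (1 : ℂ), star (fourierSum x z) * fourierSum y z =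
      n * (star x ⬝ᵥ y) := by
  have h1 : ∀ z ∈ nthRootsFinset n (1 : ℂ), star (fourierSum x z) * fourierSum y z =
      ∑ r, ∑ s, star (x r) * y s * z ^ ((s : ℤ) - (r : ℤ)) := by
    intro z hz
    have hz0 := ne_zero_of_mem_nthRootsFinset hn hz
    have hst : star z = z⁻¹ := (Complex.inv_eq_conj (norm_of_mem_nthRootsFinset hn hz)).symm
    rw [fourierSum, fourierSum, star_sum, Finset.sum_mul_sum]
    refine Finset.sum_congr rfl fun r _ => Finset.sum_congr rfl fun s _ => ?_
    rw [star_mul', star_pow, hst, zpow_sub₀ hz0, zpow_natCast, zpow_natCast]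
    ring
  rw [Finset.sum_congr rfl h1, Finset.sum_comm, dotProduct, Finset.mul_sum]
  refine Finset.sum_congr rfl fun r _ => ?_
  rw [Finset.sum_comm, Finset.sum_eq_single_of_mem r (Finset.mem_univ _)]
  · rw [← Finset.mul_sum, sum_nthRootsFinset_zpow hn]
    simp
    ring
  · intro s _ hs
    rw [← Finset.mul_sum, sum_nthRootsFinset_zpow hn, if_neg, mul_zero]
    rintro ⟨b, hb⟩
    have h2 := r.2
    have h3 := s.2
    have hb1 : b < 1 := by nlinarith
    have hb2 : -1 < b := by nlinarith
    have hb0 : b = 0 := by omega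
    rw [hb0, mul_zero] at hb
    exact hs (Fin.ext (by omega))

theorem sum_norm_sq_fourierSum {n : ℕ} (hn : 0 < n) (x : Fin n → ℂ) :
    ∑ z ∈ nthRootsFinset n (1 : ℂ), ‖fourierSum x z‖ ^ 2 = n * ∑ r, ‖x r‖ ^ 2 := by
  have h := sum_star_fourierSum_mul hn x x
  have h1 : ∀ w : ℂ, star w * w = ((‖w‖ ^ 2 : ℝ) : ℂ) := by
    intro w
    rw [Complex.star_def, Complex.conj_mul', Complex.ofReal_pow]
  simp only [dotProduct, Pi.star_apply, h1] at h
  exact_mod_cast h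

theorem fourierSum_sub {n : ℕ} (x y : Fin n → ℂ) (z : ℂ) :
    fourierSum (x - y) z = fourierSum x z - fourierSum y z := by
  simp only [fourierSum, Pi.sub_apply, sub_mul, Finset.sum_sub_distrib]

/-- The discrete Fourier transform diagonalizes circulant matrices. -/
theorem fourierSum_circ_mulVec {n : ℕ} (hn : 0 < n) (a : ℤ →₀ ℂ) (v : Fin n → ℂ) {z : ℂ}
    (hz : z ^ n = 1) : fourierSum (circ n a *ᵥ v) z = laurentEval a z * fourierSum v z := by
  have hn' : (0 : ℤ) < n := by exact_mod_cast hn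
  have hz0 : z ≠ 0 := ne_zero_of_mem_nthRootsFinset hn ((mem_nthRootsFinset hn _).2 hz)
  have h1 : ∀ (j : ℤ) (s : Fin n), ∑ r : Fin n,
      (if (n : ℤ) ∣ j - (((r : ℕ) : ℤ) - ((s : ℕ) : ℤ)) then z ^ (r : ℕ) else 0) =
      z ^ j * z ^ (s : ℕ) := by
    intro j s
    have h0 : 0 ≤ (j + s) % n := Int.emod_nonneg _ hn'.ne'
    have hlt : (j + s) % n < n := Int.emod_lt_of_pos _ hn'
    have hmod := Int.emod_add_mul_ediv (j + s) n
    rw [Finset.sum_eq_single_of_mem (⟨((j + s) % n).toNat, by omega⟩ : Fin n) (Finset.mem_univ _)]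
    · rw [if_pos]
      · dsimp only
        rw [← zpow_natCast, Int.toNat_of_nonneg h0, ← zpow_natCast z s, ← zpow_add₀ hz0]
        conv_rhs => rw [← hmod]
        rw [zpow_add₀ hz0, zpow_mul, zpow_natCast, hz, one_zpow, mul_one]
      · refine ⟨(j + s) / n, ?_⟩
        dsimp only
        rw [Int.toNat_of_nonneg h0]
        linarith
    · intro r _ hr
      rw [if_neg]
      rintro ⟨b, hb⟩
      apply hr
      apply Fin.ext
      dsimp only
      have h2 : (j + s) % n = r := by
        rw [show j + (s : ℤ) = r + n * b by linarith, Int.add_mul_emod_self_left,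
          Int.emod_eq_of_lt (by omega) (by have := r.2; omega)]
      omega
  have h2 : ∀ r : Fin n, (circ n a *ᵥ v) r * z ^ (r : ℕ) = ∑ j ∈ a.support, ∑ s : Fin n,
      a j * v s *
      (if (n : ℤ) ∣ j - (((r : ℕ) : ℤ) - ((s : ℕ) : ℤ)) then z ^ (r : ℕ) else 0) := by
    intro r
    rw [Matrix.mulVec, dotProduct, Finset.sum_comm, Finset.sum_mul]
    refine Finset.sum_congr rfl fun s _ => ?_
    rw [circ, Matrix.of_apply, Finsupp.sum, Finset.sum_mul, Finset.sum_mul]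
    refine Finset.sum_congr rfl fun j _ => ?_
    split_ifs <;> ring
  rw [fourierSum, Finset.sum_congr rfl fun r _ => h2 r, Finset.sum_comm, laurentEval,
    Finsupp.sum, fourierSum, Finset.sum_mul_sum]
  refine Finset.sum_congr rfl fun j _ => ?_
  rw [Finset.sum_comm]
  refine Finset.sum_congr rfl fun s _ => ?_
  rw [← Finset.mul_sum, h1]
  ring

/-- The energy of a circulant matrix in terms of the discrete Fourier transform. -/
theorem mul_energySq_circ {n : ℕ} (hn : 0 < n) (a : ℤ →₀ ℂ) (x : Fin n → ℂ) :
    n * energySq (circ n a) x =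
      ∑ z ∈ nthRootsFinset n (1 : ℂ), (laurentEval a z).re * ‖fourierSum x z‖ ^ 2 := by
  have h := congrArg Complex.re (sum_star_fourierSum_mul hn x (circ n a *ᵥ x))
  rw [← Complex.ofReal_natCast, Complex.re_ofReal_mul] at h
  rw [energySq, ← h, Complex.re_sum]
  refine Finset.sum_congr rfl fun z hz => ?_
  rw [fourierSum_circ_mulVec hn a x ((mem_nthRootsFinset hn _).1 hz), mul_left_comm,
    Complex.star_def, Complex.conj_mul', ← Complex.ofReal_pow, Complex.re_mul_ofReal]

theorem energySq_diag_circ {n : ℕ} (a : ℤ →₀ ℂ) (x : Fin n → ℂ) :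
    energySq (Matrix.diagonal (circ n a).diag) x ≤ (a.sum fun _ c => ‖c‖) * ∑ r, ‖x r‖ ^ 2 := by
  rw [energySq, dotProduct, Complex.re_sum, Finset.mul_sum]
  refine Finset.sum_le_sum fun r _ => ?_
  rw [Matrix.mulVec_diagonal, Pi.star_apply, mul_left_comm, Complex.star_def, Complex.conj_mul',
    ← Complex.ofReal_pow, Complex.re_mul_ofReal]
  refine mul_le_mul_of_nonneg_right ((Complex.re_le_norm _).trans ?_) (by positivity)
  rw [Matrix.diag_apply, circ, Matrix.of_apply, Finsupp.sum, Finsupp.sum]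
  refine (norm_sum_le _ _).trans (Finset.sum_le_sum fun j _ => ?_)
  split_ifs <;> simp

/-- The grid transfer operator multiplies the Fourier transform, pulled back along `z ↦ z ^ g`, by
the symbol of the mask. -/
theorem fourierSum_gridTransfer_mulVec {g : ℕ} (hg : 0 < g) (p : ℤ →₀ ℝ) (k : ℕ)
    (y : Fin (g ^ k) → ℂ) {z : ℂ} (hz : z ^ g ^ (k + 1) = 1) :
    fourierSum (gridTransfer g p k *ᵥ y) z = maskSymbol p z * fourierSum y (z ^ g) := by
  rw [gridTransfer, ← Matrix.mulVec_mulVec, fourierSum_circ_mulVec (by positivity) _ _ hz,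
    laurentEval_maskCoeff]
  congr 1
  have h1 : ∀ s : Fin (g ^ (k + 1)), ((downsampling g (g ^ k) (g ^ (k + 1)))ᵀ *ᵥ y) s *
      z ^ (s : ℕ) = ∑ i : Fin (g ^ k), if (s : ℕ) = g * i then y i * z ^ (g * (i : ℕ)) else 0 := by
    intro s
    rw [Matrix.mulVec, dotProduct, Finset.sum_mul]
    refine Finset.sum_congr rfl fun i _ => ?_
    rw [Matrix.transpose_apply, downsampling, Matrix.of_apply]
    split_ifs with h
    · rw [h, one_mul]
    · ring
  rw [fourierSum, Finset.sum_congr rfl fun s _ => h1 s, Finset.sum_comm, fourierSum]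
  refine Finset.sum_congr rfl fun i _ => ?_
  have hi : g * (i : ℕ) < g ^ (k + 1) := by
    rw [pow_succ']
    exact Nat.mul_lt_mul_of_pos_left i.2 hg
  rw [Finset.sum_eq_single_of_mem (⟨g * i, hi⟩ : Fin (g ^ (k + 1))) (Finset.mem_univ _),
    if_pos rfl, pow_mul]
  intro s _ hs
  rw [if_neg]
  intro h
  exact hs (Fin.ext h)

/-- The values of the Fourier transform at the roots of unity can be prescribed. -/
theorem exists_fourierSum_eq {n : ℕ} (hn : 0 < n) (T : ℂ → ℂ) :
    ∃ y : Fin n → ℂ, ∀ w ∈ nthRootsFinset n (1 : ℂ), fourierSum y w = T w := by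
  have hn' : (n : ℂ) ≠ 0 := by exact_mod_cast hn.ne'
  refine ⟨fun j => (n : ℂ)⁻¹ * ∑ v ∈ nthRootsFinset n (1 : ℂ), T v * (v⁻¹) ^ (j : ℕ),
    fun w hw => ?_⟩
  have h1 : ∀ j : Fin n, ((n : ℂ)⁻¹ * ∑ v ∈ nthRootsFinset n (1 : ℂ), T v * (v⁻¹) ^ (j : ℕ)) *
      w ^ (j : ℕ) = ∑ v ∈ nthRootsFinset n (1 : ℂ), (n : ℂ)⁻¹ * T v * (w / v) ^ (j : ℕ) := by
    intro j
    rw [mul_assoc, Finset.sum_mul, Finset.mul_sum]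
    refine Finset.sum_congr rfl fun v _ => ?_
    rw [div_eq_mul_inv, mul_pow]
    ring
  rw [fourierSum, Finset.sum_congr rfl fun j _ => h1 j, Finset.sum_comm,
    Finset.sum_eq_single_of_mem w hw]
  · rw [← Finset.mul_sum, div_self (ne_zero_of_mem_nthRootsFinset hn hw)]
    simp only [one_pow, Finset.sum_const, Finset.card_univ, Fintype.card_fin, nsmul_eq_mul, mul_one]
    rw [mul_right_comm, inv_mul_cancel₀ hn', one_mul]
  · intro v hv hvw
    rw [← Finset.mul_sum, Fin.sum_univ_eq_sum_range (fun j => (w / v) ^ j) n]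
    have hne : w / v ≠ 1 := fun h => hvw ((div_eq_one_iff_eq
      (ne_zero_of_mem_nthRootsFinset hn hv)).1 h).symm
    rw [geom_sum_eq hne, div_pow, (mem_nthRootsFinset hn _).1 hv, (mem_nthRootsFinset hn _).1 hw]
    simp

/-- Full column rank of the grid transfer operators means that the symbol does not vanish at all
`g`-th roots of a `g`-adic root of unity. -/
theorem exists_maskSymbol_ne_zero {g : ℕ} (hg : 0 < g) {p : ℤ →₀ ℝ} {k : ℕ}
    (hrank : (gridTransfer g p k).rank = g ^ k) {z : ℂ} (hz : z ^ g ^ k = 1) :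
    ∃ w : ℂ, w ^ g = z ∧ maskSymbol p w ≠ 0 := by
  by_contra! h
  have hN : 0 < g ^ k := by positivity
  have hn : 0 < g ^ (k + 1) := by positivity
  obtain ⟨y, hy⟩ := exists_fourierSum_eq hN (fun w => if w = z then 1 else 0)
  have hPy : gridTransfer g p k *ᵥ y = 0 := by
    have h1 := sum_norm_sq_fourierSum hn (gridTransfer g p k *ᵥ y)
    rw [Finset.sum_eq_zero] at h1
    · have h2 : ∑ r, ‖(gridTransfer g p k *ᵥ y) r‖ ^ 2 = 0 :=
        (mul_eq_zero.1 h1.symm).resolve_left (by exact_mod_cast hn.ne')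
      rw [Finset.sum_eq_zero_iff_of_nonneg (fun _ _ => by positivity)] at h2
      ext r
      simpa using h2 r (Finset.mem_univ _)
    · intro w hw
      have hw' := (mem_nthRootsFinset hn _).1 hw
      rw [fourierSum_gridTransfer_mulVec hg p k y hw', hy]
      · split_ifs with hwz
        · rw [h w hwz]
          simp
        · simp
      · rw [mem_nthRootsFinset hN, ← pow_mul, ← pow_succ', hw']
  have hker : LinearMap.ker (gridTransfer g p k).mulVecLin = ⊥ := by
    have h1 := LinearMap.finrank_range_add_finrank_ker (gridTransfer g p k).mulVecLin
    rw [← Matrix.rank, hrank, Module.finrank_fin_fun] at h1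
    exact Submodule.finrank_eq_zero.1 (by omega)
  have hy0 : y = 0 := by
    have : y ∈ LinearMap.ker (gridTransfer g p k).mulVecLin := hPy
    rwa [hker, Submodule.mem_bot] at this
  have h2 := hy z ((mem_nthRootsFinset hN _).2 hz)
  simp [hy0, fourierSum] at h2

/-! ### Lower bound for the generating function -/

/-- A function that is positive away from `0` and vanishes at `0` to order exactly `m` is bounded
below by a multiple of `|x| ^ m`: near `0` by Taylor's theorem, elsewhere by compactness. -/
theorem exists_mul_abs_pow_le {f : ℝ → ℝ} {m : ℕ} (hf : ContDiff ℝ m f) (hm : 1 ≤ m)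
    (hpos : ∀ x ∈ Set.Icc (-Real.pi) Real.pi, x ≠ 0 → 0 < f x)
    (hzero : ∀ μ : ℕ, μ < m → iteratedDeriv μ f 0 = 0) (hne : iteratedDeriv m f 0 ≠ 0) :
    ∃ c : ℝ, 0 < c ∧ ∀ x ∈ Set.Icc (-Real.pi) Real.pi, c * |x| ^ m ≤ f x := by
  have hf0 : f 0 = 0 := by simpa using hzero 0 (by omega)
  set b : ℝ := iteratedDeriv m f 0 / m.factorial with hb
  have hb0 : 0 < |b| := abs_pos.2 (div_ne_zero hne (by exact_mod_cast m.factorial_ne_zero))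
  have hT : ∀ x, taylorWithinEval f m Set.univ 0 x = b * x ^ m := by
    intro x
    rw [taylor_within_apply, Finset.sum_range_succ, Finset.sum_eq_zero, zero_add]
    · rw [iteratedDerivWithin_univ, sub_zero, smul_eq_mul, hb]
      ring
    · intro k hk
      rw [iteratedDerivWithin_univ, hzero k (Finset.mem_range.1 hk), smul_zero]
  have ho := (taylor_isLittleO_univ (x₀ := 0) hf).bound (half_pos hb0)
  obtain ⟨δ, hδ, hball⟩ := Metric.eventually_nhds_iff.1 ho
  have hnear : ∀ x ∈ Set.Icc (-Real.pi) Real.pi, |x| < δ → |b| / 2 * |x| ^ m ≤ f x := by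
    intro x hx hxδ
    have h1 := hball (y := x) (by rwa [Real.dist_eq, sub_zero])
    rw [hT, sub_zero, Real.norm_eq_abs, Real.norm_eq_abs, abs_pow] at h1
    have h2 : 0 ≤ f x := by
      by_cases h : x = 0
      · rw [h, hf0]
      · exact (hpos x hx h).le
    have h3 : |b| * |x| ^ m ≤ |f x| + |f x - b * x ^ m| := by
      rw [← abs_pow, ← abs_mul, abs_sub_comm]
      calc |b * x ^ m| = |f x + (b * x ^ m - f x)| := by ring_nf
        _ ≤ _ := abs_add_le _ _
    rw [abs_of_nonneg h2] at h3
    linarith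
  have hK : IsCompact (Set.Icc (-Real.pi) Real.pi ∩ {x | δ ≤ |x|}) :=
    isCompact_Icc.inter_right (isClosed_le continuous_const continuous_abs)
  obtain ⟨e, he, hfar⟩ : ∃ e : ℝ, 0 < e ∧
      ∀ x ∈ Set.Icc (-Real.pi) Real.pi ∩ {x | δ ≤ |x|}, e ≤ f x := by
    rcases (Set.Icc (-Real.pi) Real.pi ∩ {x | δ ≤ |x|}).eq_empty_or_nonempty with h | h
    · exact ⟨1, one_pos, by simp [h]⟩
    · obtain ⟨x0, hx0, hmin⟩ := hK.exists_isMinOn h hf.continuous.continuousOn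
      refine ⟨f x0, hpos x0 hx0.1 ?_, fun x hx => hmin hx⟩
      rintro rfl
      have := hx0.2
      simp only [Set.mem_ofPred_eq, abs_zero] at this
      linarith
  refine ⟨min (|b| / 2) (e / Real.pi ^ m), by positivity, fun x hx => ?_⟩
  by_cases h : |x| < δ
  · exact (mul_le_mul_of_nonneg_right (min_le_left _ _) (by positivity)).trans (hnear x hx h)
  · refine le_trans ?_ (hfar x ⟨hx, not_lt.1 h⟩)
    calc min (|b| / 2) (e / Real.pi ^ m) * |x| ^ m ≤ e / Real.pi ^ m * Real.pi ^ m := by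
          gcongr
          · exact min_le_right _ _
          · exact abs_le.2 hx
      _ = e := div_mul_cancel₀ _ (by positivity)

theorem contDiff_of_eq_trigPoly {f : ℝ → ℝ} {a : ℤ →₀ ℂ} (hf : ∀ x : ℝ, (f x : ℂ) = trigPoly a x)
    {n : WithTop ℕ∞} : ContDiff ℝ n f := by
  have h1 : f = fun x => Complex.reCLM (trigPoly a x) := by
    ext x
    rw [← hf]
    simp
  rw [h1]
  refine Complex.reCLM.contDiff.comp ?_
  unfold trigPoly Finsupp.sum
  refine ContDiff.sum fun j _ => contDiff_const.mul ?_
  exact Complex.contDiff_exp.comp (contDiff_const.mul Complex.ofRealCLM.contDiff)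

theorem periodic_of_eq_trigPoly {f : ℝ → ℝ} {a : ℤ →₀ ℂ}
    (hf : ∀ x : ℝ, (f x : ℂ) = trigPoly a x) : Function.Periodic f (2 * Real.pi) := by
  intro x
  have h1 : ((f (x + 2 * Real.pi) : ℝ) : ℂ) = f x := by
    rw [hf, hf, trigPoly_eq_laurentEval, trigPoly_eq_laurentEval]
    congr 1
    rw [Complex.ofReal_add, add_mul, Complex.ofReal_mul, Complex.ofReal_ofNat]
    exact Complex.exp_periodic _
  exact_mod_cast h1

/-- On the unit circle, the Laurent polynomial of `f` is bounded below by a multiple of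
`‖z - 1‖ ^ m`. -/
theorem exists_mul_norm_sub_one_pow_le {f : ℝ → ℝ} {a : ℤ →₀ ℂ}
    (hf : ∀ x : ℝ, (f x : ℂ) = trigPoly a x)
    (hpos : ∀ x ∈ Set.Ioo (0 : ℝ) (2 * Real.pi), 0 < f x) {m : ℕ} (hm : 1 ≤ m)
    (hzero : ∀ μ : ℕ, μ < m → iteratedDeriv μ f 0 = 0) (hne : iteratedDeriv m f 0 ≠ 0) :
    ∃ c : ℝ, 0 < c ∧ ∀ z : ℂ, ‖z‖ = 1 → c * ‖z - 1‖ ^ m ≤ (laurentEval a z).re := by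
  have hpi := Real.pi_pos
  have hpos' : ∀ x ∈ Set.Icc (-Real.pi) Real.pi, x ≠ 0 → 0 < f x := by
    intro x hx hx0
    rcases lt_or_gt_of_ne hx0 with h | h
    · rw [← periodic_of_eq_trigPoly hf x]
      exact hpos _ ⟨by linarith [hx.1], by linarith⟩
    · exact hpos x ⟨h, by linarith [hx.2]⟩
  obtain ⟨c, hc, hle⟩ := exists_mul_abs_pow_le (contDiff_of_eq_trigPoly hf) hm hpos' hzero hne
  refine ⟨c, hc, fun z hz => ?_⟩
  have h1 : Complex.exp (z.arg * Complex.I) = z := by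
    have := Complex.norm_mul_exp_arg_mul_I z
    rwa [hz, Complex.ofReal_one, one_mul] at this
  have h2 : ((f z.arg : ℝ) : ℂ) = laurentEval a z := by rw [hf, trigPoly_eq_laurentEval, h1]
  rw [← h2, Complex.ofReal_re]
  refine le_trans ?_ (hle z.arg (abs_le.1 (Complex.abs_arg_le_pi z)))
  gcongr
  have h3 := Real.norm_exp_I_mul_ofReal_sub_one_le (x := z.arg)
  rwa [mul_comm, h1, Real.norm_eq_abs] at h3

/-! ### The approximation property -/

/-- Zeros of order `e` of the symbol at the nontrivial `g`-th roots of unity bound the symbol at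
`w = ω z` by the distance of `z` to `1`. -/
theorem exists_norm_maskSymbol_le {g : ℕ} (hg : 0 < g) {p : ℤ →₀ ℝ} {L e : ℕ}
    (hL : ∀ γ ∈ p.support, |γ| ≤ (L : ℤ))
    (hdvd : ∀ ω : ℂ, ω ^ g = 1 → ω ≠ 1 → (X - C ω) ^ e ∣ maskPoly p L) :
    ∃ B : ℝ, 0 < B ∧ ∀ z w : ℂ, ‖z‖ = 1 → ‖w‖ = 1 → w ^ g = z ^ g → w ≠ z →
      ‖maskSymbol p w‖ ≤ B * ‖z - 1‖ ^ e := by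
  have h1 : ∀ ω : ℂ, ∃ B : ℝ, 0 ≤ B ∧ (ω ^ g = 1 → ω ≠ 1 → ∀ w : ℂ, ‖w‖ = 1 →
      ‖maskSymbol p w‖ ≤ B * ‖w - ω‖ ^ e) := by
    intro ω
    by_cases hω : ω ^ g = 1 ∧ ω ≠ 1
    · obtain ⟨Q, hQ⟩ := hdvd ω hω.1 hω.2
      obtain ⟨B, hB⟩ := (isCompact_sphere (0 : ℂ) 1).exists_bound_of_continuousOn
        Q.continuous.continuousOn
      refine ⟨max B 0, le_max_right _ _, fun _ _ w hw => ?_⟩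
      have hw0 : w ≠ 0 := by
        rintro rfl
        simp at hw
      have h2 := congrArg norm (maskPoly_eval hL hw0)
      rw [norm_mul, norm_pow, hw, one_pow, one_mul] at h2
      rw [← h2, hQ, eval_mul, eval_pow, eval_sub, eval_X, eval_C, norm_mul, norm_pow, mul_comm]
      gcongr
      exact (hB w (by simpa using hw)).trans (le_max_left _ _)
    · exact ⟨0, le_rfl, fun h h' => absurd ⟨h, h'⟩ hω⟩
  choose B hB0 hB using h1
  have hsum : 0 ≤ ∑ ω ∈ nthRootsFinset g (1 : ℂ), B ω := Finset.sum_nonneg fun ω _ => hB0 ω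
  refine ⟨∑ ω ∈ nthRootsFinset g (1 : ℂ), B ω + 1, by linarith, fun z w hz hw hzw hne => ?_⟩
  have hz0 : z ≠ 0 := by
    rintro rfl
    simp at hz
  have hω : (w / z) ^ g = 1 := by rw [div_pow, hzw, div_self (pow_ne_zero _ hz0)]
  have hω1 : w / z ≠ 1 := fun h => hne ((div_eq_one_iff_eq hz0).1 h)
  have h2 := hB (w / z) hω hω1 w hw
  have h3 : ‖w - w / z‖ = ‖z - 1‖ := by
    have : w - w / z = w / z * (z - 1) := by field_simp
    rw [this, norm_mul, norm_div, hz, hw, div_one, one_mul]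
  rw [h3] at h2
  refine h2.trans ?_
  gcongr
  have := Finset.single_le_sum (fun ω _ => hB0 ω) ((mem_nthRootsFinset hg _).2 hω)
  linarith

theorem sum_sum_pow_eq_le {g n : ℕ} (hg : 0 < g) (h : ℂ → ℝ)
    (hh : ∀ w ∈ nthRootsFinset n (1 : ℂ), 0 ≤ h w) :
    ∑ z ∈ nthRootsFinset n (1 : ℂ), ∑ w ∈ nthRootsFinset n (1 : ℂ) with w ^ g = z ^ g, h w ≤
      g * ∑ w ∈ nthRootsFinset n (1 : ℂ), h w := by
  simp only [Finset.sum_filter]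
  rw [Finset.sum_comm, Finset.mul_sum]
  refine Finset.sum_le_sum fun w hw => ?_
  rw [← Finset.sum_filter, Finset.sum_const, nsmul_eq_mul]
  refine mul_le_mul_of_nonneg_right ?_ (hh w hw)
  have h1 : {z ∈ nthRootsFinset n (1 : ℂ) | w ^ g = z ^ g} ⊆ (nthRoots g (w ^ g)).toFinset := by
    intro z hz
    rw [Multiset.mem_toFinset, mem_nthRoots hg]
    exact (Finset.mem_filter.1 hz).2.symm
  exact_mod_cast (Finset.card_le_card h1).trans ((Multiset.toFinset_card_le _).trans
    (card_nthRoots _ _))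

/-- The approximation property, for a generating function that vanishes to order at most `m` at `1`
and a mask whose symbol does not vanish at `1` and has zeros of order `e ≥ m / 2` at the other
`g`-th roots of unity. The coarse correction `y` reproduces the Fourier coefficients of `x` at the
frequencies near `1`; the error at the remaining frequencies is controlled by the zeros of the
symbol and the lower bound for the generating function. -/
theorem approximationProperty_of_dvd {g : ℕ} (hg : 2 ≤ g) {p : ℤ →₀ ℝ} {a : ℤ →₀ ℂ} {L e m : ℕ}
    (hL : ∀ γ ∈ p.support, |γ| ≤ (L : ℤ)) (he : 1 ≤ e) (hme : m ≤ 2 * e)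
    (hdvd : ∀ ω : ℂ, ω ^ g = 1 → ω ≠ 1 → (X - C ω) ^ e ∣ maskPoly p L)
    (hp1 : maskSymbol p 1 ≠ 0) {c : ℝ} (hc : 0 < c)
    (hle : ∀ z : ℂ, ‖z‖ = 1 → c * ‖z - 1‖ ^ m ≤ (laurentEval a z).re) :
    ApproximationProperty (fun k => g ^ (k + 1)) (fun k => g ^ k)
      (fun k => circ (g ^ (k + 1)) a) (fun k => gridTransfer g p k) := by
  have hg0 : 0 < g := by omega
  obtain ⟨B, hB, hPle⟩ := exists_norm_maskSymbol_le hg0 hL hdvd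
  set b : ℝ := ‖maskSymbol p 1‖ / 2 with hb
  have hb0 : 0 < b := half_pos (norm_pos_iff.2 hp1)
  have hcont : ContinuousAt (maskSymbol p) 1 := by
    unfold maskSymbol
    refine tendsto_finsetSum _ fun γ _ => ?_
    exact (continuousAt_const.mul (continuousAt_zpow₀ _ _ (Or.inl one_ne_zero)))
  -- Near `1` the symbol is bounded below; since it is small at the companions `w` of a point `z`
  -- near `1`, such a `w` cannot be near `1` as well.
  obtain ⟨ε, hε, hε1, hεB, hεP⟩ : ∃ ε : ℝ, 0 < ε ∧ ε ≤ 1 ∧ B * ε ≤ b ∧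
      ∀ z : ℂ, ‖z - 1‖ < ε → b < ‖maskSymbol p z‖ := by
    have h1 : ∀ᶠ z in 𝓝 (1 : ℂ), b < ‖maskSymbol p z‖ :=
      hcont.norm.eventually (lt_mem_nhds (by linarith [norm_pos_iff.2 hp1]))
    obtain ⟨δ, hδ, hδP⟩ := Metric.eventually_nhds_iff.1 h1
    refine ⟨min δ (min 1 (b / B)), by positivity, (min_le_right _ _).trans (min_le_left _ _), ?_,
      fun z hz => hδP ?_⟩
    · calc B * min δ (min 1 (b / B)) ≤ B * (b / B) := by
            gcongr
            exact (min_le_right _ _).trans (min_le_right _ _)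
        _ = b := mul_div_cancel₀ _ hB.ne'
    · rw [dist_eq_norm]
      exact hz.trans_le (min_le_left _ _)
  have huniq : ∀ z w : ℂ, ‖z‖ = 1 → ‖w‖ = 1 → w ^ g = z ^ g → ‖z - 1‖ < ε → ‖w - 1‖ < ε →
      w = z := by
    intro z w hz hw hzw hzε hwε
    by_contra hne
    have h1 := hPle z w hz hw hzw hne
    have h2 : ‖z - 1‖ ^ e ≤ ε := by
      calc ‖z - 1‖ ^ e ≤ ‖z - 1‖ ^ 1 :=
            pow_le_pow_of_le_one (norm_nonneg _) (hzε.le.trans hε1) he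
        _ ≤ ε := by rw [pow_one]; exact hzε.le
    have h3 : B * ‖z - 1‖ ^ e ≤ B * ε := mul_le_mul_of_nonneg_left h2 hB.le
    linarith [hεP w hwε]
  set A₁ : ℝ := 2 / (c * ε ^ m) with hA₁
  set A₂ : ℝ := 2 * B ^ 2 / (b ^ 2 * c) with hA₂
  have hA₁0 : 0 < A₁ := by positivity
  have hA₂0 : 0 < A₂ := by positivity
  set Ca : ℝ := a.sum fun _ c => ‖c‖ with hCa
  have hCa0 : 0 ≤ Ca := Finset.sum_nonneg fun _ _ => norm_nonneg _
  refine ⟨Ca * (A₁ + A₂ * g) + 1, by positivity, fun k x => ?_⟩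
  have hn : 0 < g ^ (k + 1) := by positivity
  have hN : 0 < g ^ k := by positivity
  set U := nthRootsFinset (g ^ (k + 1)) (1 : ℂ) with hU
  set F : ℂ → ℝ := fun z => (laurentEval a z).re with hF
  have hnorm : ∀ z ∈ U, ‖z‖ = 1 := fun z hz => norm_of_mem_nthRootsFinset hn hz
  have hF0 : ∀ z ∈ U, 0 ≤ F z := fun z hz =>
    le_trans (by positivity) (hle z (hnorm z hz))
  have hfar : ∀ z ∈ U, ε ≤ ‖z - 1‖ → 2 ≤ A₁ * F z := by
    intro z hz hzε
    have h1 : c * ε ^ m ≤ F z := le_trans (by gcongr) (hle z (hnorm z hz))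
    rw [hA₁, div_mul_eq_mul_div, le_div_iff₀ (by positivity)]
    linarith
  classical
  obtain ⟨y, hy⟩ := exists_fourierSum_eq hN fun v =>
    if h : ∃ z ∈ U, z ^ g = v ∧ ‖z - 1‖ < ε then fourierSum x h.choose / maskSymbol p h.choose
    else 0
  refine ⟨y, ?_⟩
  have hres : ∀ z ∈ U, ‖fourierSum (x - gridTransfer g p k *ᵥ y) z‖ ^ 2 ≤
      A₁ * (F z * ‖fourierSum x z‖ ^ 2) +
        A₂ * ∑ w ∈ U with w ^ g = z ^ g, F w * ‖fourierSum x w‖ ^ 2 := by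
    intro z hz
    have hz1 : z ^ g ^ (k + 1) = 1 := (mem_nthRootsFinset hn _).1 hz
    have hzg : z ^ g ∈ nthRootsFinset (g ^ k) (1 : ℂ) := by
      rw [mem_nthRootsFinset hN, ← pow_mul, ← pow_succ', hz1]
    rw [fourierSum_sub, fourierSum_gridTransfer_mulVec hg0 p k y hz1, hy _ hzg]
    have hterm : ∀ w ∈ U, 0 ≤ F w * ‖fourierSum x w‖ ^ 2 := fun w hw =>
      mul_nonneg (hF0 w hw) (by positivity)
    have hsum0 : 0 ≤ ∑ w ∈ U with w ^ g = z ^ g, F w * ‖fourierSum x w‖ ^ 2 :=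
      Finset.sum_nonneg fun w hw => hterm w (Finset.mem_filter.1 hw).1
    have hX : ε ≤ ‖z - 1‖ → 2 * ‖fourierSum x z‖ ^ 2 ≤ A₁ * (F z * ‖fourierSum x z‖ ^ 2) := by
      intro h
      rw [← mul_assoc]
      exact mul_le_mul_of_nonneg_right (hfar z hz h) (by positivity)
    split_ifs with h
    · obtain ⟨hwU, hwz, hwε⟩ := h.choose_spec
      set w := h.choose
      have hPw := hεP w hwε
      have hPw0 : maskSymbol p w ≠ 0 := norm_pos_iff.1 (hb0.trans hPw)
      by_cases hzw : z = w
      · rw [hzw, mul_div_cancel₀ _ hPw0, sub_self, norm_zero, zero_pow two_ne_zero, ← hzw]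
        have := hterm z hz
        positivity
      · have hzε : ε ≤ ‖z - 1‖ := by
          by_contra! h'
          exact hzw (huniq w z (hnorm w hwU) (hnorm z hz) hwz.symm hwε h')
        have h1 := hPle w z (hnorm w hwU) (hnorm z hz) hwz.symm hzw
        have h2 : c * ‖maskSymbol p z‖ ^ 2 ≤ B ^ 2 * F w := by
          have h3 : (‖w - 1‖ ^ e) ^ 2 ≤ ‖w - 1‖ ^ m := by
            rw [← pow_mul, mul_comm]
            exact pow_le_pow_of_le_one (norm_nonneg _) (hwε.le.trans hε1) hme
          calc c * ‖maskSymbol p z‖ ^ 2 ≤ c * (B * ‖w - 1‖ ^ e) ^ 2 := by gcongr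
            _ = B ^ 2 * (c * (‖w - 1‖ ^ e) ^ 2) := by ring
            _ ≤ B ^ 2 * (c * ‖w - 1‖ ^ m) := by gcongr
            _ ≤ B ^ 2 * F w := by
              gcongr
              exact hle w (hnorm w hwU)
        have h4 : 2 * ‖maskSymbol p z * (fourierSum x w / maskSymbol p w)‖ ^ 2 ≤
            A₂ * (F w * ‖fourierSum x w‖ ^ 2) := by
          have h5 : b ^ 2 ≤ ‖maskSymbol p w‖ ^ 2 := by gcongr
          have h6 : ‖maskSymbol p z‖ ^ 2 ≤ B ^ 2 * F w / c := by
            rw [le_div_iff₀ hc]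
            linarith
          have h7 : 0 ≤ F w := hF0 w hwU
          rw [norm_mul, norm_div, mul_pow, div_pow]
          calc 2 * (‖maskSymbol p z‖ ^ 2 * (‖fourierSum x w‖ ^ 2 / ‖maskSymbol p w‖ ^ 2))
              ≤ 2 * (B ^ 2 * F w / c * (‖fourierSum x w‖ ^ 2 / b ^ 2)) := by gcongr
            _ = A₂ * (F w * ‖fourierSum x w‖ ^ 2) := by
              rw [hA₂]
              field_simp
        have h8 : F w * ‖fourierSum x w‖ ^ 2 ≤
            ∑ w ∈ U with w ^ g = z ^ g, F w * ‖fourierSum x w‖ ^ 2 :=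
          Finset.single_le_sum (f := fun w => F w * ‖fourierSum x w‖ ^ 2)
            (fun w hw => hterm w (Finset.mem_filter.1 hw).1)
            (Finset.mem_filter.2 ⟨hwU, hwz⟩)
        have h9 := mul_le_mul_of_nonneg_left h8 hA₂0.le
        have h10 := norm_sub_le (fourierSum x z) (maskSymbol p z * (fourierSum x w / maskSymbol p w))
        have h11 := hX hzε
        have h12 := sq_nonneg (‖fourierSum x z‖ -
          ‖maskSymbol p z * (fourierSum x w / maskSymbol p w)‖)
        have h13 := pow_le_pow_left₀ (norm_nonneg _) h10 2
        linarith
    · have hzε : ε ≤ ‖z - 1‖ := by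
        by_contra! h'
        exact h ⟨z, hz, rfl, h'⟩
      rw [mul_zero, sub_zero]
      have h1 := hX hzε
      have h2 := mul_nonneg hA₂0.le hsum0
      have h3 : 0 ≤ ‖fourierSum x z‖ ^ 2 := by positivity
      linarith
  have hn' : (0 : ℝ) < ((g ^ (k + 1) : ℕ) : ℝ) := by exact_mod_cast hn
  have hE := mul_energySq_circ hn a x
  have htotal : ((g ^ (k + 1) : ℕ) : ℝ) * ∑ r, ‖(x - gridTransfer g p k *ᵥ y) r‖ ^ 2 ≤
      (A₁ + A₂ * g) * (((g ^ (k + 1) : ℕ) : ℝ) * energySq (circ (g ^ (k + 1)) a) x) := by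
    rw [← sum_norm_sq_fourierSum hn, hE]
    refine (Finset.sum_le_sum hres).trans ?_
    rw [Finset.sum_add_distrib, ← Finset.mul_sum, ← Finset.mul_sum, add_mul, mul_assoc A₂]
    have := sum_sum_pow_eq_le (n := g ^ (k + 1)) hg0 (fun w => F w * ‖fourierSum x w‖ ^ 2)
      fun w hw => mul_nonneg (hF0 w hw) (by positivity)
    gcongr
  rw [mul_left_comm] at htotal
  have h1 := le_of_mul_le_mul_left htotal hn'
  have h2 : 0 ≤ energySq (circ (g ^ (k + 1)) a) x := by
    refine nonneg_of_mul_nonneg_right (a := ((g ^ (k + 1) : ℕ) : ℝ)) ?_ hn'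
    rw [hE]
    exact Finset.sum_nonneg fun z hz => mul_nonneg (hF0 z hz) (by positivity)
  calc energySq (Matrix.diagonal (circ (g ^ (k + 1)) a).diag) (x - gridTransfer g p k *ᵥ y)
      ≤ Ca * ∑ r, ‖(x - gridTransfer g p k *ᵥ y) r‖ ^ 2 := energySq_diag_circ a _
    _ ≤ Ca * ((A₁ + A₂ * g) * energySq (circ (g ^ (k + 1)) a) x) := by gcongr
    _ ≤ (Ca * (A₁ + A₂ * g) + 1) * energySq (circ (g ^ (k + 1)) a) x := by linarith

end SubdivisionTGM

end

theorem theorem3p2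
    -- a real trigonometric polynomial `f` with coefficients `a`
    (f : ℝ → ℝ) (a : ℤ →₀ ℂ) (hf : ∀ x : ℝ, (f x : ℂ) = SubdivisionTGM.trigPoly a x)
    -- positive on `(0, 2π)`, with a zero of exact order `m` at `0`
    (hpos : ∀ x ∈ Set.Ioo (0 : ℝ) (2 * Real.pi), 0 < f x)
    (m : ℕ) (hm : 1 ≤ m)
    (hzero : ∀ μ : ℕ, μ < m → iteratedDeriv μ f 0 = 0) (hne : iteratedDeriv m f 0 ≠ 0)
    -- an odd-symmetric mask and arity `g`
    (g : ℕ) (hg : 2 ≤ g) (p : ℤ →₀ ℝ) (hsymm : ∀ α : ℤ, p (-α) = p α)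
    (hconv : SubdivisionTGM.IsConvergent g p)
    (hgen : SubdivisionTGM.GeneratesPolynomials g p (⌈(m : ℚ) / 2⌉₊ - 1))
    -- grid transfer operators have full column rank
    (hrank : ∀ k : ℕ, (SubdivisionTGM.gridTransfer g p k).rank = g ^ k) :
    SubdivisionTGM.ApproximationProperty (fun k => g ^ (k + 1)) (fun k => g ^ k)
      (fun k => SubdivisionTGM.circ (g ^ (k + 1)) a)
      (fun k => SubdivisionTGM.gridTransfer g p k) := by
  have hg0 : 0 < g := by omega
  obtain ⟨φ, hφ, hpoly⟩ := hgen
  set d := ⌈(m : ℚ) / 2⌉₊ - 1 with hd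
  have hmd : m ≤ 2 * (d + 1) := by
    have h1 : (m : ℚ) ≤ 2 * ⌈(m : ℚ) / 2⌉₊ := by linarith [Nat.le_ceil ((m : ℚ) / 2)]
    have h2 : m ≤ 2 * ⌈(m : ℚ) / 2⌉₊ := by exact_mod_cast h1
    omega
  obtain ⟨L, hL⟩ := SubdivisionTGM.exists_support_bound p
  have hsupp := hφ.finite_support_translate hg
  have hroot : ∀ (k : ℕ) (z : ℂ), z ^ g ^ k = 1 →
      ∃ w : ℂ, w ^ g = z ∧ SubdivisionTGM.maskSymbol p w ≠ 0 :=
    fun k z hz => SubdivisionTGM.exists_maskSymbol_ne_zero hg0 (hrank k) hz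
  have hdvd : ∀ ω : ℂ, ω ^ g = 1 → ω ≠ 1 →
      (Polynomial.X - Polynomial.C ω) ^ (d + 1) ∣ SubdivisionTGM.maskPoly p L :=
    fun ω hω hω1 => SubdivisionTGM.pow_dvd_maskPoly (hφ := hsupp) hg0.ne' hL hsymm
      (hφ.refinement hg) hpoly hω hω1
      (SubdivisionTGM.translateComb_zpow_ne_zero hg0.ne' hsymm (hφ.refinement hg)
        (hconv.exists_ne_zero hg hφ) hroot (k := 1) hω1 (by rwa [pow_one]))
  -- The symbol vanishes at the nontrivial `g`-th roots of unity, so that full rank on the coarsest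
  -- grid, which consists of a single point, forces it not to vanish at `1`.
  have hp1 : SubdivisionTGM.maskSymbol p 1 ≠ 0 := by
    obtain ⟨w, hw, hpw⟩ := hroot 0 1 (one_pow _)
    by_cases hw1 : w = 1
    · rwa [← hw1]
    · exfalso
      have hw0 : w ≠ 0 := by
        rintro rfl
        rw [zero_pow hg0.ne'] at hw
        exact zero_ne_one hw
      obtain ⟨Q, hQ⟩ := hdvd w hw hw1
      have h1 := SubdivisionTGM.maskPoly_eval hL hw0
      rw [hQ] at h1
      simp [hw0, hpw] at h1
  obtain ⟨c, hc, hle⟩ := SubdivisionTGM.exists_mul_norm_sub_one_pow_le hf hpos hm hzero hne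
  exact SubdivisionTGM.approximationProperty_of_dvd hg hL (Nat.le_add_left 1 d) hmd hdvd hp1 hc hle
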